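/- Let $d,d_0\in\mathbb N$, $N_0,M_0\in\mathbb N$, $\Delta>0$, $\lambda>0$. Let $\sigma:\mathbb R^d\to\mathbb R^{d\times d}$ be measurable with $a=\sigma\sigma^\top$ invertible everywhere; let $f_0$ be a probability density on $\mathbb R^d$ with $\int\|x\|^pf_0(x)\,dx<\infty$ for all $p>0$ and $\int f_0|\ln f_0|\,dx<\infty$; let $g(\cdot|x)$, $x\in\mathbb R^d$, be probability densities on $\mathbb R^{d_0}$, jointly measurable in $(y,x)$; and let $n_1,\dots,n_{M_0}\in\{0,\dots,N_0\}$ be the indices of the observation times. Let $\mathcal H_K$ be the reproducing kernel Hilbert space of functions $b:\mathbb R^d\to\mathbb R^d$ with matrix-valued reproducing kernel $K$. For $b\in\mathcal H_K$ let $$p_X(x_{0:N_0}|b)=f_0(x_0)\prod_{n=1}^{N_0}\mathcal N_d\big(x_n\,\big|\,x_{n-1}+b(x_{n-1})\Delta,\ a(x_{n-1})\Delta\big)$$ be the density of the discretized diffusion $X(s_{n+1})=X(s_n)+b(X(s_n))\Delta+\sigma(X(s_n))\xi_{n+1}\sqrt\Delta$, with $\xi_n$ i.i.d. $\mathcal N_d(0,I)$.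 Fix observations $y_{1:M_0}\in(\mathbb R^{d_0})^{M_0}$ and put $$p_Y(y_{1:M_0}|b)=\int p_X(x_{0:N_0}|b)\prod_{m=1}^{M_0}g(y_m|x_{n_m})\,dx_{0:N_0},\qquad L(b)=-\ln p_Y(y_{1:M_0}|b)+\lambda\|b\|_{\mathcal H_K}^2,$$ where $p_Y(y_{1:M_0}|b)>0$ for some $b\in\mathcal H_K$ (equivalently, for every $b$). Let $\nu_b$ be the filtering distribution, with density $p_X(x_{0:N_0}|b)\prod_m g(y_m|x_{n_m})/p_Y(y_{1:M_0}|b)$. For a probability measure $\eta$ on $(\mathbb R^d)^{N_0+1}$ put $$R(b,\eta)=-\int\ln p_X(x_{0:N_0}|b)\,\eta(dx_{0:N_0})+\lambda\|b\|^2_{\mathcal H_K},\qquad \Phi(\eta)=\operatorname*{arg\,min}_{b\in\mathcal H_K}R(b,\eta),$$ and let $\mathcal S=\{b\in\mathcal H_K: b=\Phi(\nu_b)\}$, that is, the set of $b$ which are the unique global minimizer of $R(\cdot,\nu_b)$. Assume that $K$ is continuous in each argument and $u\mapsto K(u,u)$ is continuous, and that for some constants $C_K,C_\sigma,C_a,C_g\ge0$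 and exponents $k,s,\alpha\ge0$, for all $u,x\in\mathbb R^d$ and $y\in\mathbb R^{d_0}$, $$\|K(u,u)\|_{\rm op}\le C_K(1+\|u\|^k),\quad \|\sigma(u)\|_{\rm op}\le C_\sigma(1+\|u\|^s),\quad \|a^{-1}(u)\|_{\rm op}\le C_a(1+\|u\|^\alpha),\quad g(y|x)\le C_g.$$ Then: (i) $\mathcal S$ is weakly sequentially closed in $\mathcal H_K$ (and hence also norm closed). (ii) Weak and strong convergence are equivalent on $\mathcal S$: for every sequence $(b_L)$ in $\mathcal S$ and every $b_*\in\mathcal H_K$, $b_L\to b_*$ weakly if and only if $b_L\to b_*$ in norm. (iii) Every local minimizer of $L$ on $\mathcal H_K$ (for the norm topology) belongs to $\mathcal S$. In particular, every global minimizer of $L$ (the penalized maximum likelihood estimator) belongs to $\mathcal S$. (iv) If $\mathcal H_K$ is infinite-dimensional, then $\mathcal S$ is nowhere dense in the norm topology. -/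

import Mathlib

open MeasureTheory Filter Topology

noncomputable section

/-- The state space `ℝ^d`, with the Euclidean norm and Lebesgue measure. -/
abbrev Vec (d : ℕ) := EuclideanSpace ℝ (Fin d)

/-- Discretized trajectories `x_{0:N} = (x_0, …, x_N)`. -/
abbrev Traj (d N : ℕ) := Fin (N + 1) → Vec d

/-- The spectral norm of a square matrix (operator norm for the Euclidean norm). -/
def specNorm {d : ℕ} (A : Matrix (Fin d) (Fin d) ℝ) : ℝ :=
  ‖Matrix.toEuclideanCLM (n := Fin d) (𝕜 := ℝ) A‖

/-- The density at `x` of the normal distribution on `ℝ^d` with mean `m` and nonsingular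
covariance matrix `C`. -/
def normalDensity {d : ℕ} (m : Vec d) (C : Matrix (Fin d) (Fin d) ℝ) (x : Vec d) : ℝ :=
  (Real.sqrt ((2 * Real.pi) ^ d * C.det))⁻¹ *
    Real.exp (-(1 / 2) *
      inner ℝ (x - m) (Matrix.toEuclideanCLM (n := Fin d) (𝕜 := ℝ) C⁻¹ (x - m)))

/-- The known data of the problem: state dimension `d`, observation dimension `d₀`, `N` time
steps and `M` observations. -/
structure SDEModel (d d₀ N M : ℕ) where
  /-- the time step `Δ` -/
  step : ℝ
  /-- the diffusion coefficient `σ` -/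
  diff : Vec d → Matrix (Fin d) (Fin d) ℝ
  /-- the density `f₀` of the initial state `X(s_0)` -/
  init : Vec d → ℝ
  /-- `obs y x` is the observation density `g(y | x)` -/
  obs : Vec d₀ → Vec d → ℝ
  /-- the `m`-th observation is made at the grid point with index `obsTime m` -/
  obsTime : Fin M → Fin (N + 1)
  /-- the regularization parameter `λ` -/
  reg : ℝ

namespace SDEModel

variable {d d₀ N M : ℕ} (P : SDEModel d d₀ N M)

/-- `a(x) = σ(x) σ(x)ᵀ`. -/
def diffSq (x : Vec d) : Matrix (Fin d) (Fin d) ℝ :=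
  P.diff x * (P.diff x).transpose

/-- The density `p_X(x_{0:N} | b)` of the chain
`X(s_{n+1}) = X(s_n) + b(X(s_n)) Δ + σ(X(s_n)) ξ_{n+1} √Δ`. -/
def pathDensity (b : Vec d → Vec d) (x : Traj d N) : ℝ :=
  P.init (x 0) * ∏ n : Fin N,
    normalDensity (x n.castSucc + P.step • b (x n.castSucc))
      (P.step • P.diffSq (x n.castSucc)) (x n.succ)

/-- The joint density `p_{X,Y}(x_{0:N}, y_{1:M} | b)`. -/
def jointDensity (y : Fin M → Vec d₀) (b : Vec d → Vec d) (x : Traj d N) : ℝ :=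
  P.pathDensity b x * ∏ m : Fin M, P.obs (y m) (x (P.obsTime m))

/-- The likelihood `p_Y(y_{1:M} | b)`. -/
def likelihood (y : Fin M → Vec d₀) (b : Vec d → Vec d) : ℝ :=
  ∫ x : Traj d N, P.jointDensity y b x

/-- The filtering distribution `ν_b(· | y_{1:M})` of the trajectory given the data. -/
def filterMeasure (y : Fin M → Vec d₀) (b : Vec d → Vec d) : Measure (Traj d N) :=
  volume.withDensity fun x => ENNReal.ofReal (P.jointDensity y b x / P.likelihood y b)

/-- The standing conventions: `Δ, λ > 0`; `σ` is measurable and `a = σσᵀ` is invertible;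
`f₀` is a probability density with all moments and finite entropy;
`g(· | x)` is a jointly measurable family of probability densities. -/
structure Regular : Prop where
  step_pos : 0 < P.step
  reg_pos : 0 < P.reg
  diff_measurable : ∀ i j, Measurable fun u => P.diff u i j
  diffSq_invertible : ∀ u, IsUnit (P.diffSq u)
  init_measurable : Measurable P.init
  init_nonneg : ∀ u, 0 ≤ P.init u
  init_integral : ∫⁻ u, ENNReal.ofReal (P.init u) = 1
  init_moments : ∀ p : ℝ, 0 < p → Integrable fun u => ‖u‖ ^ p * P.init u
  init_entropy : Integrable fun u => P.init u * Real.log (P.init u)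
  obs_measurable : Measurable fun z : Vec d₀ × Vec d => P.obs z.1 z.2
  obs_nonneg : ∀ y x, 0 ≤ P.obs y x
  obs_integral : ∀ x, ∫⁻ y, ENNReal.ofReal (P.obs y x) = 1

section RKHSPart

variable (H : Type*) [NormedAddCommGroup H] [InnerProductSpace ℝ H]
  [RKHS ℝ H (Vec d) (Vec d)]

/-- Continuity of the kernel `K` of `H`, and polynomial growth of `K(u,u)`, `σ`, `a⁻¹`;
boundedness of `g`. -/
structure Growth [CompleteSpace H] : Prop where
  kernel_continuous_left : ∀ v, Continuous fun u => RKHS.kernel H u v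
  kernel_continuous_right : ∀ u, Continuous fun v => RKHS.kernel H u v
  kernel_continuous_diag : Continuous fun u => RKHS.kernel H u u
  kernel_growth : ∃ C k : ℝ, 0 ≤ C ∧ 0 ≤ k ∧ ∀ u, ‖RKHS.kernel H u u‖ ≤ C * (1 + ‖u‖ ^ k)
  diff_growth : ∃ C k : ℝ, 0 ≤ C ∧ 0 ≤ k ∧ ∀ u, specNorm (P.diff u) ≤ C * (1 + ‖u‖ ^ k)
  diffSq_inv_growth : ∃ C k : ℝ, 0 ≤ C ∧ 0 ≤ k ∧
    ∀ u, specNorm (P.diffSq u)⁻¹ ≤ C * (1 + ‖u‖ ^ k)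
  obs_bounded : ∃ C : ℝ, 0 ≤ C ∧ ∀ y x, P.obs y x ≤ C

variable {H}

/-- The penalized negative log-likelihood `L(b) = -ln p_Y(y_{1:M} | b) + λ ‖b‖²`. -/
def loss (y : Fin M → Vec d₀) (b : H) : ℝ :=
  -Real.log (P.likelihood y b) + P.reg * ‖b‖ ^ 2

/-- The risk `R(b, η) = -∫ ln p_X(x_{0:N} | b) η(dx_{0:N}) + λ ‖b‖²`. -/
def risk (b : H) (η : Measure (Traj d N)) : ℝ :=
  -(∫ x, Real.log (P.pathDensity b x) ∂η) + P.reg * ‖b‖ ^ 2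

variable (H)

/-- The set of global minimizers over `H` of `R(·, η)`. -/
def riskArgmin (η : Measure (Traj d N)) : Set H :=
  {b | ∀ b' : H, P.risk b η ≤ P.risk b' η}

/-- The stationary set `{b ∈ H : b = Φ(ν_b)}`, where `Φ(η) = argmin R(·, η)`:
the equation `b = Φ(ν_b)` says that `b` is the one and only minimizer of `R(·, ν_b)`. -/
def stationarySet (y : Fin M → Vec d₀) : Set H :=
  {b | P.riskArgmin H (P.filterMeasure y b) = {b}}

end RKHSPart

end SDEModel

end

/-!
The idea is to treat the risk `R(·, ν_b)` as an exact quadratic function on `H` and to compare it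
with the loss.

*Quadratic structure.* The drift enters `ln p_X(x | b)` quadratically:
`p_X(x | b + h) = p_X(x | b) exp (score b h x - quadPart h x)`, where the score is linear in `h` and
`quadPart` is a nonnegative quadratic form (`SDEModel.pathDensity_add`). All the functions involved
grow polynomially along a trajectory, and the chain has moments of every order, so that
`R(b + h, ν_b)` has an exact second-order expansion in `h` (`SDEModel.risk_add`). Because of the
penalty it is strictly convex, and `b = Φ(ν_b)` is equivalent to the stationarity equation
`∫ score b h dν_b = 2 λ ⟪b, h⟫` for all `h` (`SDEModel.mem_stationarySet_iff`).

*Local minimizers.* Jensen's inequality under `ν_b` gives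
`L(b + h) - L(b) ≤ R(b + h, ν_b) - R(b, ν_b)` (`SDEModel.loss_add_le`), the inequality behind the EM
algorithm. At a local minimizer of `L`, the right side is therefore nonnegative for small `h`, its
linear part vanishes, and the stationarity equation follows without differentiating `L`.

*Weak continuity.* If `b_n → b` weakly, then `b_n → b` pointwise, so the path densities converge
pointwise. They are probability densities whose moments are bounded uniformly for drifts in a
bounded subset of `H` (`SDEModel.exists_integral_pow_mul_pathDensity_le`); a common integrable
majorant need not exist, but Fatou's lemma still gives convergence of the integrals of functions of
polynomial growth (`tendsto_integral_of_abs_le_mul_density`). Hence both sides of the stationarity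
equation, multiplied by the likelihood, are weakly sequentially continuous jointly in `b` and `h`.
With `h` fixed, the stationary set is weakly sequentially closed. With `h = b_n`, the norms
`‖b_n‖` converge to `‖b‖`, so weak convergence is strong convergence. A ball in the stationary set
would then contradict the weak convergence of `b₀ + r e_n` to `b₀` for an orthonormal sequence
`e_n`.

*Moments.* One step of the chain is `u ↦ u + b(u) Δ + σ(u) √Δ z` with `z` standard normal
(`SDEModel.lintegral_transitionDensity_mul`), whose norm is polynomial in `u` and linear in `z`.
The transition operator thus maps polynomial weights to functions bounded by polynomial weights,
and iterating it along the chain (`lintegral_chain`) reduces every moment to a moment of `f₀`.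
-/

noncomputable section

/-! ### Weak convergence in Hilbert spaces -/

section WeakConvergence

variable {H : Type*} [NormedAddCommGroup H] [InnerProductSpace ℝ H]

theorem tendsto_toWeakSpace_iff_inner [CompleteSpace H] {ι : Type*} {l : Filter ι}
    {b : ι → H} {b' : H} :
    Tendsto (fun n => toWeakSpace ℝ H (b n)) l (𝓝 (toWeakSpace ℝ H b')) ↔
      ∀ v : H, Tendsto (fun n => inner ℝ v (b n)) l (𝓝 (inner ℝ v b')) := by
  have hinj : Function.Injective (topDualPairing ℝ H).flip := by
    intro x y hxy
    refine ext_inner_left ℝ fun v => ?_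
    simpa using congrArg (fun g => g (InnerProductSpace.toDual ℝ H v)) hxy
  refine (WeakBilin.tendsto_iff_forall_eval_tendsto (B := (topDualPairing ℝ H).flip) hinj).trans ?_
  constructor
  · intro h v
    exact h (InnerProductSpace.toDual ℝ H v)
  · intro h φ
    have := h ((InnerProductSpace.toDual ℝ H).symm φ)
    simp only [InnerProductSpace.toDual_symm_apply] at this
    exact this

/-- Weakly convergent sequences are bounded, by the uniform boundedness principle. -/
theorem exists_norm_le_of_tendsto_inner [CompleteSpace H] {b : ℕ → H} {b' : H}
    (hb : ∀ v : H, Tendsto (fun n => inner ℝ v (b n)) atTop (𝓝 (inner ℝ v b'))) :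
    ∃ C, ∀ n, ‖b n‖ ≤ C := by
  obtain ⟨C, hC⟩ := banach_steinhaus (g := fun n => innerSL ℝ (b n)) fun v => by
    obtain ⟨C, hC⟩ := (hb v).norm.bddAbove_range
    refine ⟨C, fun n => ?_⟩
    rw [innerSL_apply_apply, real_inner_comm]
    exact hC ⟨n, rfl⟩
  exact ⟨C, fun n => by simpa using hC n⟩

/-- Weak convergence together with convergence of the norms gives strong convergence. -/
theorem tendsto_of_tendsto_inner_of_tendsto_norm {ι : Type*} {l : Filter ι} {b : ι → H} {b' : H}
    (hb : ∀ v : H, Tendsto (fun n => inner ℝ v (b n)) l (𝓝 (inner ℝ v b')))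
    (hn : Tendsto (fun n => ‖b n‖ ^ 2) l (𝓝 (‖b'‖ ^ 2))) : Tendsto b l (𝓝 b') := by
  rw [tendsto_iff_norm_sub_tendsto_zero]
  have h : Tendsto (fun n => ‖b n - b'‖ ^ 2) l (𝓝 0) := by
    have h1 := (hn.sub ((hb b').const_mul 2)).add_const (‖b'‖ ^ 2)
    rw [real_inner_self_eq_norm_sq] at h1
    convert h1 using 2 with n
    · rw [norm_sub_sq_real, real_inner_comm]
    · ring
  simpa using h.sqrt

theorem Orthonormal.tendsto_inner_zero {e : ℕ → H} (he : Orthonormal ℝ e) (v : H) :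
    Tendsto (fun n => inner ℝ v (e n)) atTop (𝓝 0) := by
  have h := (he.inner_products_summable v).tendsto_atTop_zero.sqrt
  simp only [Real.sqrt_sq (norm_nonneg _), Real.sqrt_zero] at h
  simpa only [real_inner_comm] using tendsto_zero_iff_norm_tendsto_zero.2 h

theorem exists_orthonormal_nat_of_not_finiteDimensional (h : ¬ FiniteDimensional ℝ H) :
    ∃ e : ℕ → H, Orthonormal ℝ e := by
  have hinf : Infinite (Module.Basis.ofVectorSpaceIndex ℝ H) := by
    by_contra hf
    rw [not_infinite_iff_finite] at hf
    exact h (Module.Finite.of_basis (Module.Basis.ofVectorSpace ℝ H))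
  have hli := (Module.Basis.ofVectorSpace ℝ H).linearIndependent.comp _
    (Infinite.natEmbedding _).injective
  exact ⟨_, InnerProductSpace.gramSchmidtNormed_orthonormal hli⟩

end WeakConvergence

/-! ### A dominated convergence theorem with varying probability densities -/

section Convergence

variable {α : Type*} [MeasurableSpace α] {μ : Measure α}

/-- One half of the convergence theorem below. Fatou's lemma is applied to
`f n + K * p n + δ * w ^ 2 * p n`, which is nonnegative for `K = 1 / (4 * δ)`; the middle term
contributes the same constant `K` for every `n`, the last one at most `δ * M`. -/
theorem eventually_integral_sub_le_of_neg_mul_le {p f : ℕ → α → ℝ} {q g w : α → ℝ} {M : ℝ}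
    (hp0 : ∀ n x, 0 ≤ p n x) (hp : ∀ n, Integrable (p n) μ) (hp1 : ∀ n, ∫ x, p n x ∂μ = 1)
    (hq : Integrable q μ) (hq1 : ∫ x, q x ∂μ = 1)
    (hpq : ∀ x, Tendsto (fun n => p n x) atTop (𝓝 (q x)))
    (hwp : ∀ n, Integrable (fun x => w x ^ 2 * p n x) μ)
    (hM : ∀ n, ∫ x, w x ^ 2 * p n x ∂μ ≤ M)
    (hwq : Integrable (fun x => w x ^ 2 * q x) μ)
    (hf : ∀ n, Integrable (f n) μ) (hg : Integrable g μ)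
    (hfg : ∀ x, Tendsto (fun n => f n x) atTop (𝓝 (g x)))
    (hfw : ∀ n x, -(w x * p n x) ≤ f n x) {ε : ℝ} (hε : 0 < ε) :
    ∀ᶠ n in atTop, ∫ x, g x ∂μ - ε ≤ ∫ x, f n x ∂μ := by
  have hM0 : 0 ≤ M := (integral_nonneg fun x => mul_nonneg (sq_nonneg _) (hp0 0 x)).trans (hM 0)
  set δ : ℝ := ε / (2 * (M + 1)) with hδ
  have hδ0 : 0 < δ := by positivity
  have hδM : δ * M ≤ ε / 2 := by
    rw [hδ, div_mul_eq_mul_div, div_le_div_iff₀ (by positivity) (by positivity)]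
    nlinarith
  set K : ℝ := 1 / (4 * δ) with hK
  have hKw : ∀ t : ℝ, t ≤ K + δ * t ^ 2 := fun t => by
    have h : K + δ * t ^ 2 - t = δ * (t - 1 / (2 * δ)) ^ 2 := by
      rw [hK]; field_simp; ring
    nlinarith [mul_nonneg hδ0.le (sq_nonneg (t - 1 / (2 * δ)))]
  have hq0 : ∀ x, 0 ≤ q x := fun x => ge_of_tendsto' (hpq x) fun n => hp0 n x
  have hlim : ∀ x, Tendsto (fun n => f n x + (K * p n x + δ * (w x ^ 2 * p n x))) atTop
      (𝓝 (g x + (K * q x + δ * (w x ^ 2 * q x)))) := fun x =>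
    (hfg x).add (((hpq x).const_mul K).add (((hpq x).const_mul _).const_mul δ))
  have hnn : ∀ n x, 0 ≤ f n x + (K * p n x + δ * (w x ^ 2 * p n x)) := fun n x => by
    nlinarith [hfw n x, mul_nonneg (sub_nonneg.2 (hKw (w x))) (hp0 n x)]
  have hnn' : ∀ x, 0 ≤ g x + (K * q x + δ * (w x ^ 2 * q x)) := fun x =>
    ge_of_tendsto' (hlim x) fun n => hnn n x
  have hint : ∀ n, Integrable (fun x => f n x + (K * p n x + δ * (w x ^ 2 * p n x))) μ :=
    fun n => (hf n).add (((hp n).const_mul K).add ((hwp n).const_mul δ))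
  have hint' : Integrable (fun x => g x + (K * q x + δ * (w x ^ 2 * q x))) μ :=
    hg.add ((hq.const_mul K).add (hwq.const_mul δ))
  have hval : ∀ n, ∫ x, f n x + (K * p n x + δ * (w x ^ 2 * p n x)) ∂μ
      = ∫ x, f n x ∂μ + (K + δ * ∫ x, w x ^ 2 * p n x ∂μ) := fun n => by
    have h1 := integral_add (hf n) (((hp n).const_mul K).add ((hwp n).const_mul δ))
    have h2 := integral_add ((hp n).const_mul K) ((hwp n).const_mul δ)
    simp only [Pi.add_apply, integral_const_mul, hp1, mul_one] at h1 h2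
    rw [h1, h2]
  have hval' : ∫ x, g x + (K * q x + δ * (w x ^ 2 * q x)) ∂μ
      = ∫ x, g x ∂μ + (K + δ * ∫ x, w x ^ 2 * q x ∂μ) := by
    have h1 := integral_add hg ((hq.const_mul K).add (hwq.const_mul δ))
    have h2 := integral_add (hq.const_mul K) (hwq.const_mul δ)
    simp only [Pi.add_apply, integral_const_mul, hq1, mul_one] at h1 h2
    rw [h1, h2]
  have hfatou : ENNReal.ofReal (∫ x, g x + (K * q x + δ * (w x ^ 2 * q x)) ∂μ) ≤
      liminf (fun n => ENNReal.ofReal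
        (∫ x, f n x + (K * p n x + δ * (w x ^ 2 * p n x)) ∂μ)) atTop := by
    have h := lintegral_liminf_le' (μ := μ) (u := atTop)
      (f := fun n x => ENNReal.ofReal (f n x + (K * p n x + δ * (w x ^ 2 * p n x))))
      fun n => (hint n).aemeasurable.ennreal_ofReal
    rw [ofReal_integral_eq_lintegral_ofReal hint' (ae_of_all _ hnn')]
    simp_rw [fun n => ofReal_integral_eq_lintegral_ofReal (hint n) (ae_of_all _ (hnn n))]
    refine le_trans (le_of_eq (lintegral_congr fun x => ?_)) h
    exact ((ENNReal.continuous_ofReal.tendsto _).comp (hlim x)).liminf_eq.symm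
  set A := ∫ x, g x + (K * q x + δ * (w x ^ 2 * q x)) ∂μ with hA
  have hA0 : 0 ≤ δ * ∫ x, w x ^ 2 * q x ∂μ :=
    mul_nonneg hδ0.le (integral_nonneg fun x => mul_nonneg (sq_nonneg _) (hq0 x))
  have key : ∀ᶠ n in atTop,
      A - ε / 2 ≤ ∫ x, f n x + (K * p n x + δ * (w x ^ 2 * p n x)) ∂μ := by
    by_cases hc : A - ε / 2 < 0
    · exact Eventually.of_forall fun n => hc.le.trans (integral_nonneg (hnn n))
    · have hlt : ENNReal.ofReal (A - ε / 2) < ENNReal.ofReal A :=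
        (ENNReal.ofReal_lt_ofReal_iff (by linarith)).2 (by linarith)
      filter_upwards [eventually_lt_of_lt_liminf (hlt.trans_le hfatou)] with n hn
      exact ((ENNReal.ofReal_lt_ofReal_iff_of_nonneg (not_lt.1 hc)).1 hn).le
  filter_upwards [key] with n hn
  rw [hval] at hn
  rw [hval'] at hA
  nlinarith [mul_le_mul_of_nonneg_left (hM n) hδ0.le]

/-- If probability densities `p n` converge pointwise to a probability density `q`, then the
integrals of functions `f n` dominated by `w * p n` converge, provided that the second moments of
`w` under `p n` are bounded. -/
theorem tendsto_integral_of_abs_le_mul_density {p f : ℕ → α → ℝ} {q g w : α → ℝ} {M : ℝ}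
    (hp0 : ∀ n x, 0 ≤ p n x) (hp : ∀ n, Integrable (p n) μ) (hp1 : ∀ n, ∫ x, p n x ∂μ = 1)
    (hq : Integrable q μ) (hq1 : ∫ x, q x ∂μ = 1)
    (hpq : ∀ x, Tendsto (fun n => p n x) atTop (𝓝 (q x)))
    (hwp : ∀ n, Integrable (fun x => w x ^ 2 * p n x) μ)
    (hM : ∀ n, ∫ x, w x ^ 2 * p n x ∂μ ≤ M)
    (hwq : Integrable (fun x => w x ^ 2 * q x) μ)
    (hf : ∀ n, Integrable (f n) μ) (hg : Integrable g μ)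
    (hfg : ∀ x, Tendsto (fun n => f n x) atTop (𝓝 (g x)))
    (hfw : ∀ n x, |f n x| ≤ w x * p n x) :
    Tendsto (fun n => ∫ x, f n x ∂μ) atTop (𝓝 (∫ x, g x ∂μ)) := by
  rw [Metric.tendsto_nhds]
  intro ε hε
  have h1 := eventually_integral_sub_le_of_neg_mul_le hp0 hp hp1 hq hq1 hpq hwp hM hwq hf hg hfg
    (fun n x => (abs_le.1 (hfw n x)).1) (half_pos hε)
  have h2 := eventually_integral_sub_le_of_neg_mul_le hp0 hp hp1 hq hq1 hpq hwp hM hwq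
    (fun n => (hf n).neg) hg.neg (fun x => (hfg x).neg)
    (fun n x => neg_le_neg (abs_le.1 (hfw n x)).2) (half_pos hε)
  filter_upwards [h1, h2] with n hn1 hn2
  simp only [Pi.neg_apply, integral_neg] at hn2
  rw [Real.dist_eq, abs_lt]
  constructor <;> linarith

end Convergence

/-! ### Marginals of Markov chains with transition densities -/

section MarkovChain

open scoped ENNReal

variable {E : Type*} [MeasureSpace E] [SigmaFinite (volume : Measure E)]

/-- The transition operator `(T φ)(u) = ∫ Q(u, v) φ(v) dv` of a transition density `Q`. -/
def transitionOp (Q : E → E → ℝ≥0∞) (φ : E → ℝ≥0∞) (u : E) : ℝ≥0∞ := ∫⁻ v, Q u v * φ v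

theorem measurable_transitionOp {Q : E → E → ℝ≥0∞} (hQ : Measurable (Function.uncurry Q))
    {φ : E → ℝ≥0∞} (hφ : Measurable φ) : Measurable (transitionOp Q φ) :=
  Measurable.lintegral_prod_right' (f := fun z : E × E => Q z.1 z.2 * φ z.2)
    (hQ.mul (hφ.comp measurable_snd))

theorem lintegral_fin_succ {n : ℕ} (F : (Fin (n + 1) → E) → ℝ≥0∞) (hF : Measurable F) :
    ∫⁻ x, F x = ∫⁻ x' : Fin n → E, ∫⁻ v, F (Fin.cons v x') := by
  have h := (volume_preserving_piFinSuccAbove (fun _ : Fin (n + 1) => E) 0).symm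
  rw [← h.lintegral_comp hF, Measure.volume_eq_prod,
    lintegral_prod_symm' (fun z => F ((MeasurableEquiv.piFinSuccAbove (fun _ => E) 0).symm z))
      (hF.comp h.measurable)]
  refine lintegral_congr fun x' => lintegral_congr fun v => ?_
  simp [MeasurableEquiv.piFinSuccAbove, Fin.insertNthEquiv]

/-- The marginal at time `n` of the chain with initial density `f` and transition density `Q`. -/
theorem lintegral_chain {Q : E → E → ℝ≥0∞} (hQ : Measurable (Function.uncurry Q))
    (hQ1 : ∀ u, ∫⁻ v, Q u v = 1) (N : ℕ) (n : Fin (N + 1)) {f φ : E → ℝ≥0∞}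
    (hf : Measurable f) (hφ : Measurable φ) :
    ∫⁻ x : Fin (N + 1) → E, f (x 0) * (∏ i : Fin N, Q (x i.castSucc) (x i.succ)) * φ (x n)
      = ∫⁻ u, f u * ((transitionOp Q)^[n] φ) u := by
  have hQl : ∀ u, Measurable fun v => Q u v := fun u => hQ.of_uncurry_left
  have hQr : ∀ u, Measurable fun v => Q v u := fun u => hQ.of_uncurry_right
  have hm : ∀ (N : ℕ) (n : Fin (N + 1)) {f φ : E → ℝ≥0∞}, Measurable f → Measurable φ →
      Measurable fun x : Fin (N + 1) → E =>
        f (x 0) * (∏ i : Fin N, Q (x i.castSucc) (x i.succ)) * φ (x n) := by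
    intro N n f φ hf hφ
    refine ((hf.comp (measurable_pi_apply _)).mul (Finset.measurable_fun_prod _ fun i _ => ?_)).mul
      (hφ.comp (measurable_pi_apply _))
    have hpair : Measurable fun x : Fin (N + 1) → E => (x i.castSucc, x i.succ) :=
      (measurable_pi_apply _).prodMk (measurable_pi_apply _)
    exact hQ.comp hpair
  induction N generalizing f φ with
  | zero =>
    obtain rfl : n = 0 := Fin.fin_one_eq_zero n
    rw [lintegral_fin_succ _ (hm 0 0 hf hφ)]
    simp [volume_pi]
  | succ N ih =>
    rw [lintegral_fin_succ _ (hm _ _ hf hφ)]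
    -- Integrating out the first coordinate leaves a shorter chain with a new initial density.
    induction n using Fin.cases with
    | zero =>
      have hf1 : Measurable fun u => ∫⁻ v, f v * φ v * Q v u :=
        Measurable.lintegral_prod_left' (f := fun z : E × E => f z.1 * φ z.1 * Q z.1 z.2)
          (((hf.comp measurable_fst).mul (hφ.comp measurable_fst)).mul hQ)
      have h := ih 0 hf1 (measurable_const (a := (1 : ℝ≥0∞)))
      simp only [mul_one, Fin.val_zero, Function.iterate_zero, id_eq] at h ⊢
      have hcons : ∀ x' : Fin (N + 1) → E, ∫⁻ v, f ((Fin.cons v x' : Fin (N + 2) → E) 0) *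
          (∏ i : Fin (N + 1), Q ((Fin.cons v x' : Fin (N + 2) → E) i.castSucc)
            ((Fin.cons v x' : Fin (N + 2) → E) i.succ)) * φ ((Fin.cons v x' : Fin (N + 2) → E) 0)
          = (∫⁻ v, f v * φ v * Q v (x' 0)) * ∏ i : Fin N, Q (x' i.castSucc) (x' i.succ) := by
        intro x'
        have hmeas : Measurable fun v => f v * φ v * Q v (x' 0) := (hf.mul hφ).mul (hQr _)
        rw [← lintegral_mul_const _ hmeas]
        refine lintegral_congr fun v => ?_
        rw [Fin.prod_univ_succ]
        simp only [Fin.cons_zero, Fin.castSucc_zero, Fin.cons_succ, ← Fin.succ_castSucc]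
        ring
      simp only [hcons, h]
      rw [lintegral_lintegral_swap]
      · refine lintegral_congr fun v => ?_
        rw [lintegral_const_mul _ (hQl v), hQ1, mul_one]
      · exact (((hf.comp measurable_snd).mul (hφ.comp measurable_snd)).mul
          (hQ.comp measurable_swap)).aemeasurable
    | succ k =>
      have hf1 : Measurable fun u => ∫⁻ v, f v * Q v u :=
        Measurable.lintegral_prod_left' (f := fun z : E × E => f z.1 * Q z.1 z.2)
          ((hf.comp measurable_fst).mul hQ)
      have h := ih k hf1 hφ
      have hT : ∀ j : ℕ, Measurable ((transitionOp Q)^[j] φ) := by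
        intro j
        induction j with
        | zero => exact hφ
        | succ j hj =>
          rw [Function.iterate_succ_apply']
          exact measurable_transitionOp hQ hj
      have hcons : ∀ x' : Fin (N + 1) → E, ∫⁻ v, f ((Fin.cons v x' : Fin (N + 2) → E) 0) *
          (∏ i : Fin (N + 1), Q ((Fin.cons v x' : Fin (N + 2) → E) i.castSucc)
            ((Fin.cons v x' : Fin (N + 2) → E) i.succ)) *
              φ ((Fin.cons v x' : Fin (N + 2) → E) k.succ)
          = (∫⁻ v, f v * Q v (x' 0)) * (∏ i : Fin N, Q (x' i.castSucc) (x' i.succ)) *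
              φ (x' k) := by
        intro x'
        have hmeas : Measurable fun v => f v * Q v (x' 0) := hf.mul (hQr _)
        rw [mul_assoc, ← lintegral_mul_const _ hmeas]
        refine lintegral_congr fun v => ?_
        rw [Fin.prod_univ_succ]
        simp only [Fin.cons_zero, Fin.castSucc_zero, Fin.cons_succ, ← Fin.succ_castSucc]
        ring
      simp only [hcons, h, Fin.val_succ, Function.iterate_succ_apply']
      have hswap : ∀ u, (∫⁻ v, f v * Q v u) * ((transitionOp Q)^[(k : ℕ)] φ) u
          = ∫⁻ v, f v * Q v u * ((transitionOp Q)^[(k : ℕ)] φ) u := fun u =>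
        (lintegral_mul_const _ (hf.mul (hQr u) : Measurable fun v => f v * Q v u)).symm
      simp only [hswap]
      rw [lintegral_lintegral_swap]
      · refine lintegral_congr fun v => ?_
        have hmeas : Measurable fun u => Q v u * ((transitionOp Q)^[(k : ℕ)] φ) u :=
          (hQl v).mul (hT k)
        rw [transitionOp, ← lintegral_const_mul _ hmeas]
        simp only [mul_assoc]
      · exact (((hf.comp measurable_snd).mul (hQ.comp measurable_swap)).mul
          ((hT k).comp measurable_fst)).aemeasurable

end MarkovChain

/-! ### Normal densities -/

section NormalDensity

variable {d : ℕ}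

theorem det_toEuclideanCLM (S : Matrix (Fin d) (Fin d) ℝ) :
    (Matrix.toEuclideanCLM (n := Fin d) (𝕜 := ℝ) S).det = S.det := by
  rw [ContinuousLinearMap.det, Matrix.coe_toEuclideanCLM_eq_toEuclideanLin]
  change LinearMap.det (Matrix.toLpLin 2 2 S) = _
  rw [Matrix.toLpLin_eq_toLin, LinearMap.det_toLin]

theorem measurable_toEuclideanCLM_apply {α : Type*} [MeasurableSpace α]
    {A : α → Matrix (Fin d) (Fin d) ℝ} (hA : ∀ i j, Measurable fun u => A u i j) {v : α → Vec d}
    (hv : Measurable v) :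
    Measurable fun u => Matrix.toEuclideanCLM (n := Fin d) (𝕜 := ℝ) (A u) (v u) := by
  have h : Measurable fun u => (A u).mulVec (v u).ofLp := by
    refine measurable_pi_lambda _ fun i => ?_
    simp only [Matrix.mulVec, dotProduct]
    refine Finset.measurable_fun_sum _ fun j _ => (hA i j).mul ?_
    exact (measurable_pi_apply j).comp ((WithLp.measurable_ofLp 2 _).comp hv)
  exact (WithLp.measurable_toLp 2 _).comp h

theorem measurable_det {α : Type*} [MeasurableSpace α]
    {A : α → Matrix (Fin d) (Fin d) ℝ} (hA : ∀ i j, Measurable fun u => A u i j) :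
    Measurable fun u => (A u).det := by
  simp only [Matrix.det_apply]
  exact Finset.measurable_fun_sum _ fun σ _ => (Finset.measurable_fun_prod _ fun i _ =>
    hA _ _).const_smul _

theorem measurable_inv_apply {α : Type*} [MeasurableSpace α]
    {A : α → Matrix (Fin d) (Fin d) ℝ} (hA : ∀ i j, Measurable fun u => A u i j) (i j : Fin d) :
    Measurable fun u => (A u)⁻¹ i j := by
  simp only [Matrix.inv_def, Matrix.smul_apply, Ring.inverse_eq_inv', smul_eq_mul,
    Matrix.adjugate_apply]
  refine (measurable_det hA).inv.mul (measurable_det fun k l => ?_)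
  simp only [Matrix.updateRow_apply]
  split_ifs
  · exact measurable_const
  · exact hA _ _

/-- The density of the standard normal distribution on `ℝ^d`. -/
def stdNormalDensity (z : Vec d) : ℝ :=
  (Real.sqrt ((2 * Real.pi) ^ d))⁻¹ * Real.exp (-(1 / 2) * ‖z‖ ^ 2)

theorem lintegral_stdNormalDensity :
    ∫⁻ z : Vec d, ENNReal.ofReal (stdNormalDensity z) = 1 := by
  have h := GaussianFourier.integral_rexp_neg_mul_sq_norm (V := Vec d) (b := 1 / 2) (by norm_num)
  have hint : Integrable fun z : Vec d => Real.exp (-(1 / 2) * ‖z‖ ^ 2) := by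
    -- the integral of a non-integrable function would be zero
    by_contra hc
    rw [integral_undef hc] at h
    have : 0 < (Real.pi / (1 / 2)) ^ (Module.finrank ℝ (Vec d) / 2 : ℝ) := by positivity
    linarith
  simp only [stdNormalDensity]
  rw [← ofReal_integral_eq_lintegral_ofReal (hint.const_mul _)
    (ae_of_all _ fun z => by simp only [Pi.zero_apply]; positivity), integral_const_mul, h]
  rw [finrank_euclideanSpace_fin, Real.sqrt_eq_rpow, ← Real.rpow_natCast, ← Real.rpow_mul
    (by positivity), ← Real.rpow_neg (by positivity)]
  rw [show Real.pi / (1 / 2) = 2 * Real.pi by ring, ← Real.rpow_add (by positivity),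
    ENNReal.ofReal_eq_one]
  convert Real.rpow_zero _ using 2
  ring

theorem lintegral_stdNormalDensity_mul_pow_lt_top (m : ℕ) :
    ∫⁻ z : Vec d, ENNReal.ofReal (stdNormalDensity z) * ENNReal.ofReal ((1 + ‖z‖) ^ m) < ⊤ := by
  have h := GaussianFourier.integral_rexp_neg_mul_sq_norm (V := Vec d) (b := 1 / 4) (by norm_num)
  have hint : Integrable fun z : Vec d => Real.exp (-(1 / 4) * ‖z‖ ^ 2) := by
    -- the integral of a non-integrable function would be zero
    by_contra hc
    rw [integral_undef hc] at h
    have : 0 < (Real.pi / (1 / 4)) ^ (Module.finrank ℝ (Vec d) / 2 : ℝ) := by positivity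
    linarith
  -- `(1 + t) ^ m ≤ m! exp (1 + t)`, and `t ≤ 1 + t² / 4` leaves a Gaussian factor
  have hb : ∀ z : Vec d, stdNormalDensity z * (1 + ‖z‖) ^ m ≤
      (Real.sqrt ((2 * Real.pi) ^ d))⁻¹ * (m.factorial * Real.exp 2) *
        Real.exp (-(1 / 4) * ‖z‖ ^ 2) := fun z => by
    have h1 : (1 + ‖z‖) ^ m ≤ m.factorial * Real.exp (1 + ‖z‖) := by
      have := Real.pow_div_factorial_le_exp (1 + ‖z‖) (by positivity) m
      rw [div_le_iff₀ (by positivity)] at this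
      linarith
    have h2 : Real.exp (1 + ‖z‖) * Real.exp (-(1 / 2) * ‖z‖ ^ 2) ≤
        Real.exp 2 * Real.exp (-(1 / 4) * ‖z‖ ^ 2) := by
      rw [← Real.exp_add, ← Real.exp_add, Real.exp_le_exp]
      nlinarith [sq_nonneg (‖z‖ - 2)]
    have h3 : (0 : ℝ) ≤ (Real.sqrt ((2 * Real.pi) ^ d))⁻¹ := by positivity
    calc stdNormalDensity z * (1 + ‖z‖) ^ m
        ≤ stdNormalDensity z * (m.factorial * Real.exp (1 + ‖z‖)) :=
          mul_le_mul_of_nonneg_left h1 (by unfold stdNormalDensity; positivity)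
      _ = (Real.sqrt ((2 * Real.pi) ^ d))⁻¹ * m.factorial *
          (Real.exp (1 + ‖z‖) * Real.exp (-(1 / 2) * ‖z‖ ^ 2)) := by
          unfold stdNormalDensity; ring
      _ ≤ (Real.sqrt ((2 * Real.pi) ^ d))⁻¹ * m.factorial *
          (Real.exp 2 * Real.exp (-(1 / 4) * ‖z‖ ^ 2)) :=
          mul_le_mul_of_nonneg_left h2 (by positivity)
      _ = _ := by ring
  refine lt_of_le_of_lt (lintegral_mono fun z => ?_) (hint.const_mul
    ((Real.sqrt ((2 * Real.pi) ^ d))⁻¹ * (m.factorial * Real.exp 2))).lintegral_lt_top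
  rw [← ENNReal.ofReal_mul (by unfold stdNormalDensity; positivity)]
  exact ENNReal.ofReal_le_ofReal (hb z)

/-- If `S` is invertible and `Z` is standard normal, then `m + S Z` has density
`normalDensity m (S Sᵀ)`. -/
theorem lintegral_normalDensity_mul (m : Vec d) {S : Matrix (Fin d) (Fin d) ℝ}
    (hS : IsUnit S.det) (φ : Vec d → ENNReal) :
    ∫⁻ x, ENNReal.ofReal (normalDensity m (S * S.transpose) x) * φ x =
      ∫⁻ z, ENNReal.ofReal (stdNormalDensity z) *
        φ (m + Matrix.toEuclideanCLM (n := Fin d) (𝕜 := ℝ) S z) := by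
  set T := Matrix.toEuclideanCLM (n := Fin d) (𝕜 := ℝ) S with hT
  set T' := Matrix.toEuclideanCLM (n := Fin d) (𝕜 := ℝ) S⁻¹ with hT'
  have hTT' : T * T' = 1 := by rw [hT, hT', ← map_mul, Matrix.mul_nonsing_inv _ hS, map_one]
  have hT'T : T' * T = 1 := by rw [hT, hT', ← map_mul, Matrix.nonsing_inv_mul _ hS, map_one]
  have h1 : ∀ z, T' (T z) = z := fun z => by
    have := congrArg (fun F => F z) hT'T; simpa using this
  have h2 : ∀ z, T (T' z) = z := fun z => by
    have := congrArg (fun F => F z) hTT'; simpa using this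
  have himg : (fun z => m + T z) '' Set.univ = Set.univ := by
    rw [Set.image_univ, Set.range_eq_univ]
    exact fun x => ⟨T' (x - m), by simp [h2]⟩
  have hinj : Set.InjOn (fun z => m + T z) Set.univ := fun z _ z' _ h => by
    have := congrArg T' (add_left_cancel h)
    rwa [h1, h1] at this
  have key := lintegral_image_eq_lintegral_abs_det_fderiv_mul (volume : Measure (Vec d))
    MeasurableSet.univ (f := fun z => m + T z) (f' := fun _ => T)
    (fun z _ => (T.hasFDerivAt.const_add m).hasFDerivWithinAt) hinj
    (fun x => ENNReal.ofReal (normalDensity m (S * S.transpose) x) * φ x)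
  rw [himg, setLIntegral_univ, setLIntegral_univ] at key
  rw [key]
  refine lintegral_congr fun z => ?_
  rw [← mul_assoc, ← ENNReal.ofReal_mul (abs_nonneg _)]
  congr 2
  have hinner : inner ℝ (T z) (Matrix.toEuclideanCLM (n := Fin d) (𝕜 := ℝ)
      (S * S.transpose)⁻¹ (T z)) = ‖z‖ ^ 2 := by
    have hadj : Matrix.toEuclideanCLM (n := Fin d) (𝕜 := ℝ) (S * S.transpose)⁻¹ =
        star T' * T' := by
      rw [hT', ← map_star, ← map_mul, Matrix.mul_inv_rev, Matrix.star_eq_conjTranspose,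
        Matrix.conjTranspose_eq_transpose_of_trivial, Matrix.transpose_nonsing_inv]
    rw [hadj, ContinuousLinearMap.star_eq_adjoint, mul_apply_eq_comp,
      ContinuousLinearMap.adjoint_inner_right, h1, real_inner_self_eq_norm_sq]
  have hdet : 0 < |S.det| := abs_pos.2 hS.ne_zero
  rw [det_toEuclideanCLM, normalDensity, stdNormalDensity, add_sub_cancel_left, hinner,
    Matrix.det_mul, Matrix.det_transpose, ← sq, Real.sqrt_mul (by positivity), Real.sqrt_sq_eq_abs]
  field_simp

end NormalDensity

/-! ### Polynomial growth -/

/-- The functions `φ i` are bounded by one polynomial in the norm of the argument, uniformly in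
the index `i`. -/
def PolyGrowth {ι E F : Type*} [Norm E] [Norm F] (φ : ι → E → F) : Prop :=
  ∃ (C : ℝ) (m : ℕ), 0 ≤ C ∧ ∀ i x, ‖φ i x‖ ≤ C * (1 + ‖x‖) ^ m

namespace PolyGrowth

variable {ι E F G : Type*} [SeminormedAddCommGroup E] [SeminormedAddCommGroup F]
  [SeminormedAddCommGroup G]

theorem mono {φ : ι → E → F} {ψ : ι → E → G} (hφ : PolyGrowth φ)
    (h : ∀ i x, ‖ψ i x‖ ≤ ‖φ i x‖) : PolyGrowth ψ := by
  obtain ⟨C, m, hC, hφ⟩ := hφ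
  exact ⟨C, m, hC, fun i x => (h i x).trans (hφ i x)⟩

theorem const (c : F) : PolyGrowth fun (_ : ι) (_ : E) => c :=
  ⟨‖c‖, 0, norm_nonneg _, fun _ _ => by simp⟩

theorem one_add_norm_pow_mono {C : ℝ} (hC : 0 ≤ C) {m n : ℕ} (h : m ≤ n) (x : E) :
    C * (1 + ‖x‖) ^ m ≤ C * (1 + ‖x‖) ^ n :=
  mul_le_mul_of_nonneg_left (pow_le_pow_right₀ (by linarith [norm_nonneg x]) h) hC

theorem add {φ ψ : ι → E → F} (hφ : PolyGrowth φ) (hψ : PolyGrowth ψ) :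
    PolyGrowth fun i x => φ i x + ψ i x := by
  obtain ⟨C, m, hC, hφ⟩ := hφ
  obtain ⟨D, n, hD, hψ⟩ := hψ
  refine ⟨C + D, max m n, by positivity, fun i x => (norm_add_le _ _).trans ?_⟩
  rw [add_mul]
  exact add_le_add ((hφ i x).trans (one_add_norm_pow_mono hC (le_max_left _ _) x))
    ((hψ i x).trans (one_add_norm_pow_mono hD (le_max_right _ _) x))

theorem neg {φ : ι → E → F} (hφ : PolyGrowth φ) : PolyGrowth fun i x => -φ i x :=
  hφ.mono fun _ _ => (norm_neg _).le

theorem sub {φ ψ : ι → E → F} (hφ : PolyGrowth φ) (hψ : PolyGrowth ψ) :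
    PolyGrowth fun i x => φ i x - ψ i x := by
  simpa only [sub_eq_add_neg] using hφ.add hψ.neg

theorem norm_mul_norm {φ : ι → E → F} {ψ : ι → E → G} (hφ : PolyGrowth φ) (hψ : PolyGrowth ψ) :
    PolyGrowth fun i x => ‖φ i x‖ * ‖ψ i x‖ := by
  obtain ⟨C, m, hC, hφ⟩ := hφ
  obtain ⟨D, n, hD, hψ⟩ := hψ
  refine ⟨C * D, m + n, by positivity, fun i x => ?_⟩
  rw [norm_mul, norm_norm, norm_norm]
  calc ‖φ i x‖ * ‖ψ i x‖ ≤ (C * (1 + ‖x‖) ^ m) * (D * (1 + ‖x‖) ^ n) :=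
        mul_le_mul (hφ i x) (hψ i x) (norm_nonneg _) (by positivity)
    _ = _ := by ring

theorem mul {φ ψ : ι → E → ℝ} (hφ : PolyGrowth φ) (hψ : PolyGrowth ψ) :
    PolyGrowth fun i x => φ i x * ψ i x :=
  (hφ.norm_mul_norm hψ).mono fun i x => by simp

theorem const_smul [NormedSpace ℝ F] {φ : ι → E → F} (hφ : PolyGrowth φ) (c : ℝ) :
    PolyGrowth fun i x => c • φ i x :=
  ((const c).norm_mul_norm hφ).mono fun i x => by simp [norm_smul]

theorem sum {κ : Type*} (s : Finset κ) {φ : κ → ι → E → F} (hφ : ∀ j, PolyGrowth (φ j)) :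
    PolyGrowth fun i x => ∑ j ∈ s, φ j i x := by
  classical
  induction s using Finset.induction_on with
  | empty => simpa using const (0 : F)
  | insert j s hj ih => simpa only [Finset.sum_insert hj] using (hφ j).add ih

theorem prod {κ : Type*} (s : Finset κ) {φ : κ → ι → E → ℝ} (hφ : ∀ j, PolyGrowth (φ j)) :
    PolyGrowth fun i x => ∏ j ∈ s, φ j i x := by
  classical
  induction s using Finset.induction_on with
  | empty => simpa using const (1 : ℝ)
  | insert j s hj ih => simpa only [Finset.prod_insert hj] using (hφ j).mul ih

theorem inner [InnerProductSpace ℝ F] {φ ψ : ι → E → F}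
    (hφ : PolyGrowth φ) (hψ : PolyGrowth ψ) :
    PolyGrowth fun i x => Inner.inner ℝ (φ i x) (ψ i x) :=
  (hφ.norm_mul_norm hψ).mono fun i x => by
    simpa [abs_mul] using abs_real_inner_le_norm (φ i x) (ψ i x)

theorem reindex {κ : Type*} {φ : ι → E → F} (hφ : PolyGrowth φ) (e : κ → ι) :
    PolyGrowth fun j x => φ (e j) x := by
  obtain ⟨C, m, hC, hφ⟩ := hφ
  exact ⟨C, m, hC, fun j x => hφ _ x⟩

theorem eval {N : ℕ} {φ : ι → E → F} (hφ : PolyGrowth φ) (n : Fin N) :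
    PolyGrowth fun i (x : Fin N → E) => φ i (x n) := by
  obtain ⟨C, m, hC, hφ⟩ := hφ
  refine ⟨C, m, hC, fun i x => (hφ i (x n)).trans ?_⟩
  have := norm_le_pi_norm x n
  gcongr

theorem coord {N : ℕ} (n : Fin N) : PolyGrowth fun (_ : ι) (x : Fin N → E) => x n :=
  ⟨1, 1, zero_le_one, fun i x => by linarith [norm_le_pi_norm x n]⟩

/-- Polynomial bounds with real exponents are polynomial bounds. -/
theorem of_le_rpow {φ : E → F}
    (h : ∃ C k : ℝ, 0 ≤ C ∧ 0 ≤ k ∧ ∀ u, ‖φ u‖ ≤ C * (1 + ‖u‖ ^ k)) :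
    PolyGrowth fun (_ : ι) => φ := by
  obtain ⟨C, k, hC, hk, h⟩ := h
  refine ⟨C * 2, ⌈k⌉₊, by positivity, fun _ u => (h u).trans ?_⟩
  have h1 : (1 : ℝ) ≤ (1 + ‖u‖) ^ ⌈k⌉₊ := one_le_pow₀ (by linarith [norm_nonneg u])
  have h2 : ‖u‖ ^ k ≤ (1 + ‖u‖) ^ ⌈k⌉₊ := by
    calc ‖u‖ ^ k ≤ (1 + ‖u‖) ^ k := Real.rpow_le_rpow (norm_nonneg _) (by linarith) hk
      _ ≤ (1 + ‖u‖) ^ (⌈k⌉₊ : ℝ) :=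
        Real.rpow_le_rpow_of_exponent_le (by linarith [norm_nonneg u]) (Nat.le_ceil k)
      _ = _ := Real.rpow_natCast _ _
  rw [mul_assoc]
  exact mul_le_mul_of_nonneg_left (by linarith) hC

end PolyGrowth

/-! ### The transition densities -/

namespace SDEModel

variable {d d₀ N M : ℕ} {P : SDEModel d d₀ N M}

variable (P) in
/-- The inverse `a(u)⁻¹` as an operator on `ℝ^d`. -/
def precision (u : Vec d) : Vec d →L[ℝ] Vec d :=
  Matrix.toEuclideanCLM (n := Fin d) (𝕜 := ℝ) (P.diffSq u)⁻¹

theorem isUnit_det_diff (hP : P.Regular) (u : Vec d) : IsUnit (P.diff u).det := by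
  have h := (Matrix.isUnit_iff_isUnit_det _).1 (hP.diffSq_invertible u)
  rw [diffSq, Matrix.det_mul] at h
  exact isUnit_of_mul_isUnit_left h

theorem det_diffSq_pos (hP : P.Regular) (u : Vec d) : 0 < (P.diffSq u).det := by
  rw [diffSq, Matrix.det_mul, Matrix.det_transpose]
  exact mul_self_pos.2 (isUnit_det_diff hP u).ne_zero

theorem det_step_smul_diffSq_pos (hP : P.Regular) (u : Vec d) :
    0 < (P.step • P.diffSq u).det := by
  rw [Matrix.det_smul]
  exact mul_pos (pow_pos hP.step_pos _) (det_diffSq_pos hP u)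

theorem toEuclideanCLM_inv_step_smul (hP : P.Regular) (u : Vec d) :
    Matrix.toEuclideanCLM (n := Fin d) (𝕜 := ℝ) (P.step • P.diffSq u)⁻¹ =
      P.step⁻¹ • P.precision u := by
  have h : (P.step • P.diffSq u)⁻¹ = P.step⁻¹ • (P.diffSq u)⁻¹ :=
    Matrix.inv_smul' _ (Units.mk0 P.step hP.step_pos.ne') (det_diffSq_pos hP u).ne'.isUnit
  rw [h, map_smul, precision]

theorem precision_eq_star_mul_self (P : SDEModel d d₀ N M) (u : Vec d) : P.precision u =
    star (Matrix.toEuclideanCLM (n := Fin d) (𝕜 := ℝ) (P.diff u)⁻¹) *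
      Matrix.toEuclideanCLM (n := Fin d) (𝕜 := ℝ) (P.diff u)⁻¹ := by
  rw [precision, diffSq, ← map_star, ← map_mul, Matrix.mul_inv_rev, Matrix.star_eq_conjTranspose,
    Matrix.conjTranspose_eq_transpose_of_trivial, Matrix.transpose_nonsing_inv]

theorem inner_precision_comm (u v w : Vec d) :
    inner ℝ v (P.precision u w) = inner ℝ w (P.precision u v) := by
  rw [precision_eq_star_mul_self, ContinuousLinearMap.star_eq_adjoint, mul_apply_eq_comp,
    mul_apply_eq_comp, ContinuousLinearMap.adjoint_inner_right,
    ContinuousLinearMap.adjoint_inner_right, real_inner_comm]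

theorem inner_precision_self_nonneg (u v : Vec d) : 0 ≤ inner ℝ v (P.precision u v) := by
  rw [precision_eq_star_mul_self, ContinuousLinearMap.star_eq_adjoint, mul_apply_eq_comp,
    ContinuousLinearMap.adjoint_inner_right]
  exact real_inner_self_nonneg

theorem step_smul_diffSq_eq (hP : P.Regular) (u : Vec d) :
    P.step • P.diffSq u = (Real.sqrt P.step • P.diff u) *
      (Real.sqrt P.step • P.diff u).transpose := by
  rw [Matrix.transpose_smul, Matrix.smul_mul, Matrix.mul_smul, smul_smul,
    Real.mul_self_sqrt hP.step_pos.le, diffSq]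

variable (P) in
/-- The transition density `v ↦ p(v | u)` of the chain with drift `b`. -/
def transitionDensity (b : Vec d → Vec d) (u v : Vec d) : ℝ :=
  normalDensity (u + P.step • b u) (P.step • P.diffSq u) v

theorem transitionDensity_pos (hP : P.Regular) (b : Vec d → Vec d) (u v : Vec d) :
    0 < P.transitionDensity b u v := by
  have := det_step_smul_diffSq_pos hP u
  unfold transitionDensity normalDensity
  positivity

theorem measurable_diffSq (hP : P.Regular) (i j : Fin d) :
    Measurable fun u => P.diffSq u i j := by
  simp only [diffSq, Matrix.mul_apply, Matrix.transpose_apply]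
  exact Finset.measurable_fun_sum _ fun k _ =>
    (hP.diff_measurable _ _).mul (hP.diff_measurable _ _)

theorem measurable_precision_apply (hP : P.Regular) {α : Type*} [MeasurableSpace α]
    {u v : α → Vec d} (hu : Measurable u) (hv : Measurable v) :
    Measurable fun z => P.precision (u z) (v z) :=
  measurable_toEuclideanCLM_apply
    (fun i j => (measurable_inv_apply (measurable_diffSq hP) i j).comp hu) hv

/-- The logarithm of the normalizing constant of the transition density at `u`. -/
def logNormalizer (P : SDEModel d d₀ N M) (u : Vec d) : ℝ :=
  Real.log (Real.sqrt ((2 * Real.pi) ^ d * (P.step • P.diffSq u).det))⁻¹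

theorem transitionDensity_eq_exp (hP : P.Regular) (b : Vec d → Vec d) (u v : Vec d) :
    P.transitionDensity b u v = Real.exp (logNormalizer P u - (2 * P.step)⁻¹ *
      inner ℝ (v - u - P.step • b u) (P.precision u (v - u - P.step • b u))) := by
  have := det_step_smul_diffSq_pos hP u
  rw [transitionDensity, normalDensity, toEuclideanCLM_inv_step_smul hP,
    sub_eq_add_neg (logNormalizer P u), Real.exp_add, logNormalizer, Real.exp_log (by positivity),
    sub_add_eq_sub_sub, smul_apply, real_inner_smul_right]
  congr 2
  rw [mul_inv]
  ring

theorem measurable_logNormalizer (hP : P.Regular) : Measurable (logNormalizer P) := by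
  refine Real.measurable_log.comp (Measurable.inv ?_)
  refine Measurable.sqrt (measurable_const.mul (measurable_det fun i j => ?_))
  exact (measurable_diffSq hP i j).const_smul P.step

theorem measurable_transitionDensity (hP : P.Regular) {b : Vec d → Vec d} (hb : Measurable b) :
    Measurable fun z : Vec d × Vec d => P.transitionDensity b z.1 z.2 := by
  simp only [transitionDensity_eq_exp hP]
  have hr : Measurable fun z : Vec d × Vec d => z.2 - z.1 - P.step • b z.1 :=
    (measurable_snd.sub measurable_fst).sub ((hb.comp measurable_fst).const_smul P.step)
  exact (((measurable_logNormalizer hP).comp measurable_fst).sub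
    (measurable_const.mul (hr.inner (measurable_precision_apply hP measurable_fst hr)))).exp

/-- The Euler step `v = u + b(u) Δ + σ(u) √Δ z` with standard normal `z` realizes the transition
density. -/
theorem lintegral_transitionDensity_mul (hP : P.Regular) (b : Vec d → Vec d) (u : Vec d)
    (φ : Vec d → ENNReal) :
    ∫⁻ v, ENNReal.ofReal (P.transitionDensity b u v) * φ v =
      ∫⁻ z, ENNReal.ofReal (stdNormalDensity z) * φ (u + P.step • b u +
        Matrix.toEuclideanCLM (n := Fin d) (𝕜 := ℝ) (Real.sqrt P.step • P.diff u) z) := by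
  simp only [transitionDensity, step_smul_diffSq_eq hP]
  refine lintegral_normalDensity_mul _ ?_ φ
  rw [Matrix.det_smul]
  exact ((pow_pos (Real.sqrt_pos.2 hP.step_pos) _).ne'.isUnit).mul (isUnit_det_diff hP u)

theorem lintegral_transitionDensity (hP : P.Regular) (b : Vec d → Vec d) (u : Vec d) :
    ∫⁻ v, ENNReal.ofReal (P.transitionDensity b u v) = 1 := by
  simpa [lintegral_stdNormalDensity] using lintegral_transitionDensity_mul hP b u 1

/-! ### Growth of the coefficients -/

section Growth

variable {H : Type*} [NormedAddCommGroup H] [InnerProductSpace ℝ H] [CompleteSpace H]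
  [RKHS ℝ H (Vec d) (Vec d)]

theorem norm_specNorm (A : Matrix (Fin d) (Fin d) ℝ) : ‖specNorm A‖ = specNorm A :=
  Real.norm_of_nonneg (norm_nonneg _)

theorem norm_entry_le_specNorm (A : Matrix (Fin d) (Fin d) ℝ) (i j : Fin d) :
    ‖A i j‖ ≤ specNorm A := by
  have h : A i j = (Matrix.toEuclideanCLM (n := Fin d) (𝕜 := ℝ) A
      (EuclideanSpace.single j (1 : ℝ))) i := by
    simp [Matrix.ofLp_toEuclideanCLM]
  rw [h]
  refine (PiLp.norm_apply_le _ i).trans ((ContinuousLinearMap.le_opNorm _ _).trans ?_)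
  simp [specNorm]

theorem polyGrowth_det {ι : Type*} {A : Vec d → Matrix (Fin d) (Fin d) ℝ}
    (hA : ∀ i j, PolyGrowth fun (_ : ι) u => A u i j) : PolyGrowth fun (_ : ι) u => (A u).det := by
  simp only [Matrix.det_apply]
  refine PolyGrowth.sum _ fun σ => ?_
  refine (PolyGrowth.prod Finset.univ fun i => hA (σ i) i).mono fun _ u => le_of_eq ?_
  rcases Int.units_eq_one_or (Equiv.Perm.sign σ) with h | h <;> simp [h]

theorem polyGrowth_precision (ι : Type*) (hG : P.Growth H) :
    PolyGrowth fun (_ : ι) u => P.precision u := by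
  obtain ⟨C, k, hC, hk, h⟩ := hG.diffSq_inv_growth
  exact PolyGrowth.of_le_rpow ⟨C, k, hC, hk, h⟩

theorem polyGrowth_diff (ι : Type*) (hG : P.Growth H) :
    PolyGrowth fun (_ : ι) u => specNorm (P.diff u) := by
  obtain ⟨C, k, hC, hk, h⟩ := hG.diff_growth
  exact PolyGrowth.of_le_rpow ⟨C, k, hC, hk, fun u => by rw [norm_specNorm]; exact h u⟩

theorem polyGrowth_det_diffSq (ι : Type*) (hG : P.Growth H) :
    PolyGrowth fun (_ : ι) u => (P.diffSq u).det := by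
  refine polyGrowth_det fun i j => ?_
  have h : ∀ i j, PolyGrowth fun (_ : ι) u => P.diff u i j := fun i j =>
    (polyGrowth_diff ι hG).mono fun _ u => by
      rw [norm_specNorm]; exact norm_entry_le_specNorm _ _ _
  simp only [diffSq, Matrix.mul_apply, Matrix.transpose_apply]
  exact PolyGrowth.sum _ fun k => (h i k).mul (h j k)

theorem polyGrowth_det_diffSq_inv (ι : Type*) (hG : P.Growth H) :
    PolyGrowth fun (_ : ι) u => (P.diffSq u)⁻¹.det :=
  polyGrowth_det fun _ _ => (polyGrowth_precision ι hG).mono fun _ _ =>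
    norm_entry_le_specNorm _ _ _

/-- The normalizing constant of a nondegenerate normal density involves `log (det a)`, which is
controlled by `det a` and `det a⁻¹`. -/
theorem polyGrowth_logNormalizer (ι : Type*) (hP : P.Regular) (hG : P.Growth H) :
    PolyGrowth fun (_ : ι) u => logNormalizer P u := by
  have hc : 0 < (2 * Real.pi) ^ d * P.step ^ d := by have := hP.step_pos; positivity
  set c := (2 * Real.pi) ^ d * P.step ^ d with hc_def
  have h1 := ((polyGrowth_det_diffSq ι hG).const_smul c).add
    ((polyGrowth_det_diffSq_inv ι hG).const_smul c⁻¹)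
  refine h1.mono fun _ u => ?_
  have hdet := det_diffSq_pos hP u
  have hD : (2 * Real.pi) ^ d * (P.step • P.diffSq u).det = c * (P.diffSq u).det := by
    rw [Matrix.det_smul, Fintype.card_fin, hc_def]; ring
  have hDinv : c⁻¹ * (P.diffSq u)⁻¹.det = (c * (P.diffSq u).det)⁻¹ := by
    rw [Matrix.det_nonsing_inv, Ring.inverse_eq_inv', mul_inv c]
  simp only [smul_eq_mul]
  rw [hDinv, logNormalizer, hD, Real.log_inv, Real.log_sqrt (by positivity), norm_neg]
  set D := c * (P.diffSq u).det with hD_def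
  have hD0 : 0 < D := by positivity
  have h2 : Real.log D ≤ D := (Real.log_le_sub_one_of_pos hD0).trans (by linarith)
  have h3 : -Real.log D ≤ D⁻¹ := by
    rw [← Real.log_inv]
    exact (Real.log_le_sub_one_of_pos (inv_pos.2 hD0)).trans (by linarith)
  have h4 : 0 < D⁻¹ := inv_pos.2 hD0
  rw [Real.norm_eq_abs, Real.norm_of_nonneg (by positivity), abs_le]
  constructor <;> linarith

/-- Elements of a bounded subset of `H` grow polynomially, uniformly. -/
theorem polyGrowth_apply (hG : P.Growth H) (B : ℝ) :
    PolyGrowth fun (b : Metric.closedBall (0 : H) B) u => (b : H) u := by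
  have hK : PolyGrowth fun (_ : Metric.closedBall (0 : H) B) u => RKHS.kernel H u u :=
    PolyGrowth.of_le_rpow hG.kernel_growth
  have h1 := ((PolyGrowth.const (1 : ℝ)).add
    ((PolyGrowth.const (1 : ℝ)).norm_mul_norm hK)).const_smul |B|
  refine h1.mono fun b u => (RKHS.norm_apply_le (b : H) u).trans ?_
  have hb : ‖(b : H)‖ ≤ |B| := (mem_closedBall_zero_iff.1 b.2).trans (le_abs_self B)
  have h2 : √‖RKHS.kernel H u u‖ ≤ 1 + ‖RKHS.kernel H u u‖ := by
    refine Real.sqrt_le_iff.2 ⟨by positivity, ?_⟩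
    nlinarith [norm_nonneg (RKHS.kernel H u u)]
  rw [norm_smul, norm_one, one_mul, Real.norm_of_nonneg (r := 1 + _) (by positivity),
    Real.norm_of_nonneg (abs_nonneg B)]
  exact mul_le_mul hb h2 (Real.sqrt_nonneg _) (abs_nonneg B)

/-- Continuity of the kernel makes the kernel functions norm continuous, hence the elements of `H`
continuous. -/
theorem continuous_apply_of_growth (hG : P.Growth H) (b : H) : Continuous b := by
  rw [continuous_iff_continuousAt]
  intro u
  rw [ContinuousAt, tendsto_iff_norm_sub_tendsto_zero]
  -- The squared distance of two kernel functions is given by the kernel.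
  have hsq : ∀ v, ‖RKHS.kerFun H v - RKHS.kerFun H u‖ ^ 2 = ‖RKHS.kernel H v v -
      RKHS.kernel H v u - RKHS.kernel H u v + RKHS.kernel H u u‖ := fun v => by
    rw [sq, ← ContinuousLinearMap.norm_adjoint_comp_self]
    simp only [RKHS.kernel_apply, map_sub, ContinuousLinearMap.sub_comp,
      ContinuousLinearMap.comp_sub]
    congr 1
    abel
  have h0 : Tendsto (fun v => ‖RKHS.kerFun H v - RKHS.kerFun H u‖ ^ 2) (𝓝 u) (𝓝 0) := by
    simp only [hsq]
    have h := ((((hG.kernel_continuous_diag).sub (hG.kernel_continuous_left u)).sub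
      (hG.kernel_continuous_right u)).add
        (continuous_const (y := RKHS.kernel H u u))).norm.tendsto u
    simpa using h
  have h1 : Tendsto (fun v => ‖RKHS.kerFun H v - RKHS.kerFun H u‖ * ‖b‖) (𝓝 u) (𝓝 0) := by
    have := h0.sqrt
    simp only [Real.sqrt_sq (norm_nonneg _), Real.sqrt_zero] at this
    simpa using this.mul_const ‖b‖
  refine squeeze_zero (fun _ => norm_nonneg _) (fun v => ?_) h1
  rw [← RKHS.adjoint_kerFun v b, ← RKHS.adjoint_kerFun u b, ← sub_apply,
    ← map_sub]
  refine (ContinuousLinearMap.le_opNorm _ _).trans ?_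
  rw [LinearIsometryEquiv.norm_map]

theorem measurable_apply (hG : P.Growth H) (b : H) : Measurable b :=
  (continuous_apply_of_growth hG b).measurable

/-- One Euler step grows polynomially in the current state and linearly in the noise, uniformly
for drifts in a bounded set. -/
theorem exists_euler_step_le (hG : P.Growth H) (B : ℝ) :
    ∃ (C : ℝ) (k : ℕ), 0 ≤ C ∧ ∀ b : H, ‖b‖ ≤ B → ∀ u z : Vec d,
      1 + ‖u + P.step • b u + Matrix.toEuclideanCLM (n := Fin d) (𝕜 := ℝ)
        (Real.sqrt P.step • P.diff u) z‖ ≤ C * (1 + ‖u‖) ^ k * (1 + ‖z‖) := by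
  obtain ⟨C₁, k₁, hC₁, h₁⟩ := polyGrowth_apply hG B
  obtain ⟨C₂, k₂, hC₂, h₂⟩ := polyGrowth_diff Unit hG
  refine ⟨1 + |P.step| * C₁ + Real.sqrt P.step * C₂, max (max k₁ k₂) 1, by positivity,
    fun b hb u z => ?_⟩
  set k := max (max k₁ k₂) 1
  have hb' := h₁ ⟨b, mem_closedBall_zero_iff.2 hb⟩ u
  have hs := h₂ () u
  rw [norm_specNorm] at hs
  have e1 : C₁ * (1 + ‖u‖) ^ k₁ ≤ C₁ * (1 + ‖u‖) ^ k :=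
    PolyGrowth.one_add_norm_pow_mono hC₁ ((le_max_left _ _).trans (le_max_left _ _)) u
  have e2 : C₂ * (1 + ‖u‖) ^ k₂ ≤ C₂ * (1 + ‖u‖) ^ k :=
    PolyGrowth.one_add_norm_pow_mono hC₂ ((le_max_right _ _).trans (le_max_left _ _)) u
  have e3 : 1 + ‖u‖ ≤ (1 + ‖u‖) ^ k := le_self_pow₀ (by linarith [norm_nonneg u]) (by simp [k])
  have e4 : ‖Matrix.toEuclideanCLM (n := Fin d) (𝕜 := ℝ) (Real.sqrt P.step • P.diff u) z‖ ≤
      Real.sqrt P.step * (C₂ * (1 + ‖u‖) ^ k) * ‖z‖ := by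
    refine (ContinuousLinearMap.le_opNorm _ _).trans ?_
    rw [map_smul, norm_smul, Real.norm_of_nonneg (Real.sqrt_nonneg _)]
    have := hs.trans e2
    unfold specNorm at this
    gcongr
  have e5 : ‖P.step • b u‖ ≤ |P.step| * (C₁ * (1 + ‖u‖) ^ k) := by
    rw [norm_smul, Real.norm_eq_abs]
    exact mul_le_mul_of_nonneg_left (hb'.trans e1) (abs_nonneg _)
  have e6 := norm_add₃_le (a := u) (b := P.step • b u) (c := Matrix.toEuclideanCLM (n := Fin d)
    (𝕜 := ℝ) (Real.sqrt P.step • P.diff u) z)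
  have hX : 0 ≤ (1 + ‖u‖) ^ k := by positivity
  calc _ ≤ (1 + ‖u‖) ^ k + |P.step| * (C₁ * (1 + ‖u‖) ^ k) +
        Real.sqrt P.step * (C₂ * (1 + ‖u‖) ^ k) * ‖z‖ := by linarith
    _ ≤ (1 + ‖u‖) ^ k * (1 + ‖z‖) + |P.step| * (C₁ * (1 + ‖u‖) ^ k) * (1 + ‖z‖) +
        Real.sqrt P.step * (C₂ * (1 + ‖u‖) ^ k) * (1 + ‖z‖) := by
      have hz := norm_nonneg z
      have h1 : (1 + ‖u‖) ^ k ≤ (1 + ‖u‖) ^ k * (1 + ‖z‖) :=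
        le_mul_of_one_le_right hX (by linarith)
      have h2 : |P.step| * (C₁ * (1 + ‖u‖) ^ k) ≤ |P.step| * (C₁ * (1 + ‖u‖) ^ k) * (1 + ‖z‖) :=
        le_mul_of_one_le_right (by positivity) (by linarith)
      have h3 : Real.sqrt P.step * (C₂ * (1 + ‖u‖) ^ k) * ‖z‖ ≤
          Real.sqrt P.step * (C₂ * (1 + ‖u‖) ^ k) * (1 + ‖z‖) :=
        mul_le_mul_of_nonneg_left (by linarith) (by positivity)
      linarith
    _ = _ := by ring

end Growth

/-! ### Moments of the chain -/

section Moments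

open scoped ENNReal

variable {H : Type*} [NormedAddCommGroup H] [InnerProductSpace ℝ H] [CompleteSpace H]
  [RKHS ℝ H (Vec d) (Vec d)]

variable (P) in
/-- The transition density as a function with values in `[0, ∞]`. -/
def transitionENN (b : Vec d → Vec d) (u v : Vec d) : ℝ≥0∞ :=
  ENNReal.ofReal (P.transitionDensity b u v)

theorem measurable_transitionENN (hP : P.Regular) {b : Vec d → Vec d} (hb : Measurable b) :
    Measurable (Function.uncurry (P.transitionENN b)) :=
  (measurable_transitionDensity hP hb).ennreal_ofReal

variable (d) in
/-- The weight `u ↦ (1 + ‖u‖) ^ m` with values in `[0, ∞]`. -/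
def momentWeight (m : ℕ) (u : Vec d) : ℝ≥0∞ := ENNReal.ofReal ((1 + ‖u‖) ^ m)

theorem measurable_momentWeight (m : ℕ) : Measurable (momentWeight d m) :=
  ((measurable_const.add measurable_norm).pow_const m).ennreal_ofReal

theorem exists_transitionOp_momentWeight_le (hP : P.Regular) (hG : P.Growth H) (B : ℝ) (m : ℕ) :
    ∃ (C : ℝ≥0∞) (m' : ℕ), C < ⊤ ∧ ∀ b : H, ‖b‖ ≤ B → ∀ u,
      transitionOp (P.transitionENN b) (momentWeight d m) u ≤ C * momentWeight d m' u := by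
  obtain ⟨C, k, hC, h⟩ := exists_euler_step_le hG B
  refine ⟨ENNReal.ofReal (C ^ m) * ∫⁻ z : Vec d, ENNReal.ofReal (stdNormalDensity z) *
    ENNReal.ofReal ((1 + ‖z‖) ^ m), k * m, ENNReal.mul_lt_top ENNReal.ofReal_lt_top
      (lintegral_stdNormalDensity_mul_pow_lt_top m), fun b hb u => ?_⟩
  have hmeas : Measurable fun z : Vec d => ENNReal.ofReal (stdNormalDensity z) *
      ENNReal.ofReal ((1 + ‖z‖) ^ m) := by
    unfold stdNormalDensity
    fun_prop
  rw [transitionOp]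
  simp only [transitionENN]
  rw [lintegral_transitionDensity_mul hP, mul_assoc, mul_comm (lintegral _ _), ← mul_assoc,
    ← lintegral_const_mul _ hmeas]
  refine lintegral_mono fun z => ?_
  rw [mul_left_comm]
  refine mul_le_mul_right ?_ _
  rw [momentWeight, momentWeight, ← ENNReal.ofReal_mul (by positivity),
    ← ENNReal.ofReal_mul (by positivity)]
  refine ENNReal.ofReal_le_ofReal ?_
  calc _ ≤ (C * (1 + ‖u‖) ^ k * (1 + ‖z‖)) ^ m := by
        gcongr
        exact h b hb u z
    _ = _ := by rw [mul_pow, mul_pow, pow_mul]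

theorem exists_iterate_transitionOp_momentWeight_le (hP : P.Regular) (hG : P.Growth H) (B : ℝ)
    (m n : ℕ) : ∃ (C : ℝ≥0∞) (m' : ℕ), C < ⊤ ∧ ∀ b : H, ‖b‖ ≤ B → ∀ u,
      (transitionOp (P.transitionENN b))^[n] (momentWeight d m) u ≤ C * momentWeight d m' u := by
  induction n with
  | zero => exact ⟨1, m, ENNReal.one_lt_top, fun b _ u => by simp⟩
  | succ n ih =>
    obtain ⟨C, m₁, hC, h⟩ := ih
    obtain ⟨C', m₂, hC', h'⟩ := exists_transitionOp_momentWeight_le hP hG B m₁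
    refine ⟨C * C', m₂, ENNReal.mul_lt_top hC hC', fun b hb u => ?_⟩
    rw [Function.iterate_succ_apply']
    calc transitionOp (P.transitionENN b)
          ((transitionOp (P.transitionENN b))^[n] (momentWeight d m)) u
        ≤ ∫⁻ v, C * (P.transitionENN b u v * momentWeight d m₁ v) := by
          refine lintegral_mono fun v => ?_
          rw [mul_left_comm]
          exact mul_le_mul_right (h b hb v) _
      _ = C * transitionOp (P.transitionENN b) (momentWeight d m₁) u := by
          rw [transitionOp]
          refine lintegral_const_mul _ ?_
          exact ((measurable_transitionENN hP (measurable_apply hG b)).of_uncurry_left).mul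
            (measurable_momentWeight m₁)
      _ ≤ C * (C' * momentWeight d m₂ u) := mul_le_mul_right (h' b hb u) _
      _ = _ := (mul_assoc _ _ _).symm

theorem integrable_init (hP : P.Regular) : Integrable P.init := by
  refine ⟨hP.init_measurable.aestronglyMeasurable, ?_⟩
  rw [hasFiniteIntegral_iff_ofReal (ae_of_all _ hP.init_nonneg), hP.init_integral]
  exact ENNReal.one_lt_top

theorem lintegral_init_mul_momentWeight_lt_top (hP : P.Regular) (m : ℕ) :
    ∫⁻ u, ENNReal.ofReal (P.init u) * momentWeight d m u < ⊤ := by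
  have hint : Integrable fun u => 2 ^ m * (P.init u + ‖u‖ ^ ((m : ℝ) + 1) * P.init u) :=
    ((integrable_init hP).add (hP.init_moments _ (by positivity))).const_mul _
  refine lt_of_le_of_lt (lintegral_mono fun u => ?_) hint.lintegral_lt_top
  rw [momentWeight, ← ENNReal.ofReal_mul (hP.init_nonneg u)]
  refine ENNReal.ofReal_le_ofReal ?_
  have h1 : (1 + ‖u‖) ^ m ≤ 2 ^ m * (1 + ‖u‖ ^ ((m : ℝ) + 1)) := by
    have h2 : (1 + ‖u‖) ^ m ≤ (1 + ‖u‖) ^ (m + 1) :=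
      pow_le_pow_right₀ (by linarith [norm_nonneg u]) (Nat.le_succ m)
    have h3 := add_pow_le zero_le_one (norm_nonneg u) (m + 1)
    rw [one_pow, Nat.add_sub_cancel] at h3
    have h4 : ‖u‖ ^ ((m : ℝ) + 1) = ‖u‖ ^ (m + 1) := by
      rw [← Real.rpow_natCast]; push_cast; rfl
    rw [h4]
    exact h2.trans h3
  calc P.init u * (1 + ‖u‖) ^ m ≤ P.init u * (2 ^ m * (1 + ‖u‖ ^ ((m : ℝ) + 1))) :=
        mul_le_mul_of_nonneg_left h1 (hP.init_nonneg u)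
    _ = _ := by ring

theorem pathDensity_eq (b : Vec d → Vec d) (x : Traj d N) :
    P.pathDensity b x =
      P.init (x 0) * ∏ n : Fin N, P.transitionDensity b (x n.castSucc) (x n.succ) := rfl

theorem pathDensity_nonneg (hP : P.Regular) (b : Vec d → Vec d) (x : Traj d N) :
    0 ≤ P.pathDensity b x :=
  mul_nonneg (hP.init_nonneg _) (Finset.prod_nonneg fun _ _ => (transitionDensity_pos hP b _ _).le)

theorem measurable_comp_consecutive {F : Vec d × Vec d → ℝ} (hF : Measurable F) (n : Fin N) :
    Measurable fun x : Traj d N => F (x n.castSucc, x n.succ) := by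
  have hpair : Measurable fun x : Traj d N => (x n.castSucc, x n.succ) :=
    (measurable_pi_apply n.castSucc).prodMk (measurable_pi_apply n.succ)
  exact hF.comp hpair

theorem measurable_pathDensity (hP : P.Regular) {b : Vec d → Vec d} (hb : Measurable b) :
    Measurable (P.pathDensity b) := by
  have h0 : Measurable fun x : Traj d N => P.init (x 0) :=
    hP.init_measurable.comp (measurable_pi_apply 0)
  have h1 : ∀ n : Fin N, Measurable fun x : Traj d N =>
      P.transitionDensity b (x n.castSucc) (x n.succ) := fun n =>
    measurable_comp_consecutive (F := fun z => P.transitionDensity b z.1 z.2)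
      (measurable_transitionDensity hP hb) n
  rw [funext (pathDensity_eq (P := P) b)]
  exact h0.mul (Finset.measurable_fun_prod _ fun n _ => h1 n)

theorem ofReal_pathDensity (hP : P.Regular) (b : Vec d → Vec d) (x : Traj d N) :
    ENNReal.ofReal (P.pathDensity b x) = ENNReal.ofReal (P.init (x 0)) *
      ∏ n : Fin N, P.transitionENN b (x n.castSucc) (x n.succ) := by
  rw [pathDensity_eq, ENNReal.ofReal_mul (hP.init_nonneg _), ENNReal.ofReal_prod_of_nonneg
    fun _ _ => (transitionDensity_pos hP b _ _).le]
  rfl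

/-- Expectations of functions of the state at time `n` under the path density, in terms of the
`n`-th power of the transition operator. -/
theorem lintegral_pathDensity_mul (hP : P.Regular) {b : Vec d → Vec d} (hb : Measurable b)
    (n : Fin (N + 1)) {φ : Vec d → ℝ≥0∞} (hφ : Measurable φ) :
    ∫⁻ x, ENNReal.ofReal (P.pathDensity b x) * φ (x n) =
      ∫⁻ u, ENNReal.ofReal (P.init u) * ((transitionOp (P.transitionENN b))^[n] φ) u := by
  simp only [ofReal_pathDensity hP]
  exact lintegral_chain (measurable_transitionENN hP hb) (lintegral_transitionDensity hP b) N n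
    hP.init_measurable.ennreal_ofReal hφ

theorem lintegral_pathDensity_mul_init (hP : P.Regular) {b : Vec d → Vec d} (hb : Measurable b)
    {φ : Vec d → ℝ≥0∞} (hφ : Measurable φ) :
    ∫⁻ x, ENNReal.ofReal (P.pathDensity b x) * φ (x 0) =
      ∫⁻ u, ENNReal.ofReal (P.init u) * φ u :=
  lintegral_pathDensity_mul hP hb 0 hφ

theorem lintegral_pathDensity (hP : P.Regular) {b : Vec d → Vec d} (hb : Measurable b) :
    ∫⁻ x, ENNReal.ofReal (P.pathDensity b x) = 1 := by
  simpa [hP.init_integral] using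
    lintegral_pathDensity_mul_init hP hb (measurable_const (a := (1 : ℝ≥0∞)))

theorem exists_lintegral_pathDensity_mul_pow_le (hP : P.Regular) (hG : P.Growth H) (B : ℝ)
    (m : ℕ) : ∃ C : ℝ≥0∞, C < ⊤ ∧ ∀ b : H, ‖b‖ ≤ B →
      ∫⁻ x, ENNReal.ofReal (P.pathDensity b x) * ENNReal.ofReal ((1 + ‖x‖) ^ m) ≤ C := by
  choose C k hC h using fun n : Fin (N + 1) =>
    exists_iterate_transitionOp_momentWeight_le hP hG B m n
  refine ⟨∑ n, C n * ∫⁻ u, ENNReal.ofReal (P.init u) * momentWeight d (k n) u,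
    ENNReal.sum_lt_top.2 fun n _ => ENNReal.mul_lt_top (hC n)
      (lintegral_init_mul_momentWeight_lt_top hP _), fun b hb => ?_⟩
  have hbm := measurable_apply hG b
  have hle : ∀ x : Traj d N, ENNReal.ofReal ((1 + ‖x‖) ^ m) ≤ ∑ n, momentWeight d m (x n) := by
    intro x
    obtain ⟨n, -, hn⟩ := Finset.exists_mem_eq_sup (Finset.univ : Finset (Fin (N + 1)))
      Finset.univ_nonempty fun n => ‖x n‖₊
    have hx : ‖x‖ = ‖x n‖ := by
      rw [← coe_nnnorm, ← coe_nnnorm, Pi.nnnorm_def, hn]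
    rw [hx]
    exact Finset.single_le_sum (f := fun n => momentWeight d m (x n)) (fun _ _ => zero_le)
      (Finset.mem_univ n)
  calc ∫⁻ x, ENNReal.ofReal (P.pathDensity b x) * ENNReal.ofReal ((1 + ‖x‖) ^ m)
      ≤ ∫⁻ x, ∑ n, ENNReal.ofReal (P.pathDensity b x) * momentWeight d m (x n) := by
        refine lintegral_mono fun x => ?_
        rw [← Finset.mul_sum]
        exact mul_le_mul_right (hle x) _
    _ = ∑ n, ∫⁻ x, ENNReal.ofReal (P.pathDensity b x) * momentWeight d m (x n) :=
        lintegral_finsetSum _ fun n _ => (measurable_pathDensity hP hbm).ennreal_ofReal.mul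
          ((measurable_momentWeight m).comp (measurable_pi_apply n))
    _ ≤ _ := by
        refine Finset.sum_le_sum fun n _ => ?_
        have hmeas : Measurable fun u => ENNReal.ofReal (P.init u) * momentWeight d (k n) u :=
          hP.init_measurable.ennreal_ofReal.mul (measurable_momentWeight _)
        rw [lintegral_pathDensity_mul hP hbm n (measurable_momentWeight m),
          ← lintegral_const_mul _ hmeas]
        refine lintegral_mono fun u => ?_
        rw [mul_left_comm]
        exact mul_le_mul_right (h n b hb u) _

theorem integrable_pathDensity (hP : P.Regular) {b : Vec d → Vec d} (hb : Measurable b) :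
    Integrable (P.pathDensity b) := by
  refine ⟨(measurable_pathDensity hP hb).aestronglyMeasurable, ?_⟩
  rw [hasFiniteIntegral_iff_ofReal (ae_of_all _ (pathDensity_nonneg hP b)),
    lintegral_pathDensity hP hb]
  exact ENNReal.one_lt_top

theorem integral_pathDensity (hP : P.Regular) {b : Vec d → Vec d} (hb : Measurable b) :
    ∫ x, P.pathDensity b x = 1 := by
  rw [integral_eq_lintegral_of_nonneg_ae (ae_of_all _ (pathDensity_nonneg hP b))
    (measurable_pathDensity hP hb).aestronglyMeasurable, lintegral_pathDensity hP hb,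
    ENNReal.toReal_one]

/-- All moments of the chain are finite, uniformly for drifts in a bounded set. -/
theorem exists_integral_pow_mul_pathDensity_le (hP : P.Regular) (hG : P.Growth H) (B : ℝ)
    (m : ℕ) : ∃ C : ℝ, ∀ b : H, ‖b‖ ≤ B →
      Integrable (fun x => (1 + ‖x‖) ^ m * P.pathDensity b x) ∧
        ∫ x, (1 + ‖x‖) ^ m * P.pathDensity b x ≤ C := by
  obtain ⟨C, hC, h⟩ := exists_lintegral_pathDensity_mul_pow_le hP hG B m
  refine ⟨C.toReal, fun b hb => ?_⟩
  have hbm := measurable_apply hG b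
  have hnn : ∀ x, 0 ≤ (1 + ‖x‖) ^ m * P.pathDensity b x := fun x =>
    mul_nonneg (by positivity) (pathDensity_nonneg hP b x)
  have hmeas : Measurable fun x => (1 + ‖x‖) ^ m * P.pathDensity b x :=
    ((measurable_const.add measurable_norm).pow_const m).mul (measurable_pathDensity hP hbm)
  have heq : ∫⁻ x, ENNReal.ofReal ((1 + ‖x‖) ^ m * P.pathDensity b x) ≤ C := by
    refine le_trans (le_of_eq (lintegral_congr fun x => ?_)) (h b hb)
    rw [mul_comm, ENNReal.ofReal_mul (pathDensity_nonneg hP b x)]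
  refine ⟨⟨hmeas.aestronglyMeasurable, ?_⟩, ?_⟩
  · rw [hasFiniteIntegral_iff_ofReal (ae_of_all _ hnn)]
    exact heq.trans_lt hC
  · rw [integral_eq_lintegral_of_nonneg_ae (ae_of_all _ hnn) hmeas.aestronglyMeasurable]
    exact ENNReal.toReal_mono hC.ne heq

end Moments

/-! ### Quadratic expansion of the log-density -/

section Expansion

variable (P)

/-- The residual `x_{n+1} - x_n - b(x_n) Δ` of one step. -/
def residual (b : Vec d → Vec d) (n : Fin N) (x : Traj d N) : Vec d :=
  x n.succ - x n.castSucc - P.step • b (x n.castSucc)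

/-- The drift-dependent part of `-ln p_X(x | b)`. -/
def energy (b : Vec d → Vec d) (x : Traj d N) : ℝ :=
  ∑ n : Fin N, (2 * P.step)⁻¹ *
    inner ℝ (P.residual b n x) (P.precision (x n.castSucc) (P.residual b n x))

/-- The derivative of `ln p_X(x | b)` with respect to `b` in the direction `h`. -/
def score (b h : Vec d → Vec d) (x : Traj d N) : ℝ :=
  ∑ n : Fin N, inner ℝ (P.residual b n x) (P.precision (x n.castSucc) (h (x n.castSucc)))

/-- The second-order part of `-ln p_X(x | b + h)`, a nonnegative quadratic form in `h`. -/
def quadPart (h : Vec d → Vec d) (x : Traj d N) : ℝ :=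
  ∑ n : Fin N, (P.step / 2) *
    inner ℝ (h (x n.castSucc)) (P.precision (x n.castSucc) (h (x n.castSucc)))

/-- The logarithm of the product of the normalizing constants along a trajectory. -/
def logNormalizerSum (x : Traj d N) : ℝ := ∑ n : Fin N, logNormalizer P (x n.castSucc)

variable {P}

theorem pathDensity_eq_exp (hP : P.Regular) (b : Vec d → Vec d) (x : Traj d N) :
    P.pathDensity b x = P.init (x 0) * Real.exp (P.logNormalizerSum x - P.energy b x) := by
  rw [pathDensity_eq, logNormalizerSum, energy, ← Finset.sum_sub_distrib, Real.exp_sum]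
  congr 1
  exact Finset.prod_congr rfl fun n _ => transitionDensity_eq_exp hP b _ _

theorem energy_add (hP : P.Regular) (b h : Vec d → Vec d) (x : Traj d N) :
    P.energy (b + h) x = P.energy b x - P.score b h x + P.quadPart h x := by
  have hs := hP.step_pos.ne'
  rw [energy, energy, score, quadPart, ← Finset.sum_sub_distrib, ← Finset.sum_add_distrib]
  refine Finset.sum_congr rfl fun n _ => ?_
  have hr : P.residual (b + h) n x = P.residual b n x - P.step • h (x n.castSucc) := by
    simp only [residual, Pi.add_apply, smul_add]
    abel
  rw [hr, map_sub, map_smul, inner_sub_left, inner_sub_right, inner_sub_right,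
    real_inner_smul_left, real_inner_smul_left, real_inner_smul_right, real_inner_smul_right,
    inner_precision_comm (P := P) (x n.castSucc) (h (x n.castSucc)) (P.residual b n x)]
  field_simp
  ring

theorem pathDensity_add (hP : P.Regular) (b h : Vec d → Vec d) (x : Traj d N) :
    P.pathDensity (b + h) x =
      P.pathDensity b x * Real.exp (P.score b h x - P.quadPart h x) := by
  rw [pathDensity_eq_exp hP, pathDensity_eq_exp hP, energy_add hP, mul_assoc, ← Real.exp_add]
  congr 2
  ring

theorem score_smul (b h : Vec d → Vec d) (t : ℝ) (x : Traj d N) :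
    P.score b (t • h) x = t * P.score b h x := by
  simp only [score, Finset.mul_sum, Pi.smul_apply, map_smul, real_inner_smul_right]

theorem quadPart_smul (h : Vec d → Vec d) (t : ℝ) (x : Traj d N) :
    P.quadPart (t • h) x = t ^ 2 * P.quadPart h x := by
  simp only [quadPart, Finset.mul_sum, Pi.smul_apply, map_smul, real_inner_smul_right,
    real_inner_smul_left]
  exact Finset.sum_congr rfl fun n _ => by ring

theorem integral_score_smul {H : Type*} [NormedAddCommGroup H] [InnerProductSpace ℝ H]
    [RKHS ℝ H (Vec d) (Vec d)] (b h : H) (t : ℝ) (η : Measure (Traj d N)) :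
    ∫ x, P.score b (t • h : H) x ∂η = t * ∫ x, P.score b h x ∂η := by
  simp only [RKHS.coe_smul, score_smul, integral_const_mul]

theorem integral_quadPart_smul {H : Type*} [NormedAddCommGroup H] [InnerProductSpace ℝ H]
    [RKHS ℝ H (Vec d) (Vec d)] (h : H) (t : ℝ) (η : Measure (Traj d N)) :
    ∫ x, P.quadPart (t • h : H) x ∂η = t ^ 2 * ∫ x, P.quadPart h x ∂η := by
  simp only [RKHS.coe_smul, quadPart_smul, integral_const_mul]

theorem quadPart_nonneg (hP : P.Regular) (h : Vec d → Vec d) (x : Traj d N) :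
    0 ≤ P.quadPart h x :=
  Finset.sum_nonneg fun n _ => mul_nonneg (by linarith [hP.step_pos])
    (inner_precision_self_nonneg (P := P) _ _)

theorem measurable_energy (hP : P.Regular) {b : Vec d → Vec d} (hb : Measurable b) :
    Measurable (P.energy b) := by
  refine Finset.measurable_fun_sum _ fun n _ => Measurable.const_mul ?_ _
  have hr : Measurable fun z : Vec d × Vec d => z.2 - z.1 - P.step • b z.1 :=
    (measurable_snd.sub measurable_fst).sub ((hb.comp measurable_fst).const_smul P.step)
  exact measurable_comp_consecutive
    (F := fun z => inner ℝ (z.2 - z.1 - P.step • b z.1)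
      (P.precision z.1 (z.2 - z.1 - P.step • b z.1)))
    (hr.inner (measurable_precision_apply hP measurable_fst hr)) n

theorem measurable_score (hP : P.Regular) {b h : Vec d → Vec d} (hb : Measurable b)
    (hh : Measurable h) : Measurable (P.score b h) := by
  refine Finset.measurable_fun_sum _ fun n _ => ?_
  have hr : Measurable fun z : Vec d × Vec d => z.2 - z.1 - P.step • b z.1 :=
    (measurable_snd.sub measurable_fst).sub ((hb.comp measurable_fst).const_smul P.step)
  exact measurable_comp_consecutive
    (F := fun z => inner ℝ (z.2 - z.1 - P.step • b z.1) (P.precision z.1 (h z.1)))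
    (hr.inner (measurable_precision_apply hP measurable_fst (hh.comp measurable_fst))) n

theorem measurable_quadPart (hP : P.Regular) {h : Vec d → Vec d} (hh : Measurable h) :
    Measurable (P.quadPart h) := by
  refine Finset.measurable_fun_sum _ fun n _ => Measurable.const_mul ?_ _
  have hh' : Measurable fun z : Vec d × Vec d => h z.1 := hh.comp measurable_fst
  exact measurable_comp_consecutive (F := fun z => inner ℝ (h z.1) (P.precision z.1 (h z.1)))
    (hh'.inner (measurable_precision_apply hP measurable_fst hh')) n

theorem measurable_logNormalizerSum (hP : P.Regular) : Measurable P.logNormalizerSum :=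
  Finset.measurable_fun_sum _ fun _ _ =>
    (measurable_logNormalizer hP).comp (measurable_pi_apply _)

end Expansion

section Growth

variable {H : Type*} [NormedAddCommGroup H] [InnerProductSpace ℝ H] [CompleteSpace H]
  [RKHS ℝ H (Vec d) (Vec d)] {ι : Type*}

theorem polyGrowth_precision_apply (hG : P.Growth H) (n : Fin (N + 1)) {φ : ι → Traj d N → Vec d}
    (hφ : PolyGrowth φ) : PolyGrowth fun i x => P.precision (x n) (φ i x) :=
  (((polyGrowth_precision ι hG).eval n).norm_mul_norm hφ).mono fun i x => by
    rw [norm_mul, norm_norm, norm_norm]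
    exact ContinuousLinearMap.le_opNorm _ _

variable {b h : ι → Vec d → Vec d}

theorem polyGrowth_residual (hb : PolyGrowth b) (n : Fin N) :
    PolyGrowth fun i => P.residual (b i) n :=
  ((PolyGrowth.coord n.succ).sub (PolyGrowth.coord n.castSucc)).sub
    ((hb.eval n.castSucc).const_smul P.step)

theorem polyGrowth_score (hG : P.Growth H) (hb : PolyGrowth b) (hh : PolyGrowth h) :
    PolyGrowth fun i => P.score (b i) (h i) :=
  PolyGrowth.sum _ fun n => (polyGrowth_residual hb n).inner
    (polyGrowth_precision_apply hG _ (hh.eval n.castSucc))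

theorem polyGrowth_energy (hG : P.Growth H) (hb : PolyGrowth b) :
    PolyGrowth fun i => P.energy (b i) :=
  PolyGrowth.sum _ fun n => ((polyGrowth_residual hb n).inner
    (polyGrowth_precision_apply hG _ (polyGrowth_residual hb n))).const_smul (2 * P.step)⁻¹

theorem polyGrowth_quadPart (hG : P.Growth H) (hh : PolyGrowth h) :
    PolyGrowth fun i => P.quadPart (h i) :=
  PolyGrowth.sum _ fun n => ((hh.eval n.castSucc).inner
    (polyGrowth_precision_apply hG _ (hh.eval n.castSucc))).const_smul (P.step / 2)

theorem polyGrowth_logNormalizerSum (ι : Type*) (hP : P.Regular) (hG : P.Growth H) :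
    PolyGrowth fun (_ : ι) => P.logNormalizerSum :=
  PolyGrowth.sum _ fun n => (polyGrowth_logNormalizer ι hP hG).eval n.castSucc

theorem polyGrowth_coe (hG : P.Growth H) {b : ι → H} {B : ℝ} (hb : ∀ i, ‖b i‖ ≤ B) :
    PolyGrowth fun i => (b i : Vec d → Vec d) :=
  (polyGrowth_apply hG B).reindex fun i => ⟨b i, mem_closedBall_zero_iff.2 (hb i)⟩

end Growth

/-! ### The joint density and the filtering distribution -/

section Filter

variable {H : Type*} [NormedAddCommGroup H] [InnerProductSpace ℝ H] [CompleteSpace H]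
  [RKHS ℝ H (Vec d) (Vec d)]

theorem jointDensity_nonneg (hP : P.Regular) (y : Fin M → Vec d₀) (b : Vec d → Vec d)
    (x : Traj d N) : 0 ≤ P.jointDensity y b x :=
  mul_nonneg (pathDensity_nonneg hP b x) (Finset.prod_nonneg fun _ _ => hP.obs_nonneg _ _)

theorem exists_jointDensity_le (hP : P.Regular) (hG : P.Growth H) (y : Fin M → Vec d₀) :
    ∃ C : ℝ, 0 ≤ C ∧ ∀ (b : Vec d → Vec d) (x : Traj d N),
      P.jointDensity y b x ≤ C * P.pathDensity b x := by
  obtain ⟨C, hC, h⟩ := hG.obs_bounded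
  refine ⟨C ^ M, by positivity, fun b x => ?_⟩
  rw [jointDensity, mul_comm]
  refine mul_le_mul_of_nonneg_right ?_ (pathDensity_nonneg hP b x)
  calc ∏ m : Fin M, P.obs (y m) (x (P.obsTime m)) ≤ ∏ _m : Fin M, C :=
        Finset.prod_le_prod (fun _ _ => hP.obs_nonneg _ _) fun _ _ => h _ _
    _ = C ^ M := by simp

theorem measurable_jointDensity (hP : P.Regular) (y : Fin M → Vec d₀) {b : Vec d → Vec d}
    (hb : Measurable b) : Measurable (P.jointDensity y b) := by
  have h : ∀ m : Fin M, Measurable fun x : Traj d N => P.obs (y m) (x (P.obsTime m)) := fun m => by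
    have h1 : Measurable fun u : Vec d => P.obs (y m) u :=
      hP.obs_measurable.comp (measurable_const.prodMk measurable_id)
    exact h1.comp (measurable_pi_apply _)
  exact (measurable_pathDensity hP hb).mul (Finset.measurable_fun_prod _ fun m _ => h m)

theorem jointDensity_add (hP : P.Regular) (y : Fin M → Vec d₀) (b h : Vec d → Vec d)
    (x : Traj d N) : P.jointDensity y (b + h) x =
      P.jointDensity y b x * Real.exp (P.score b h x - P.quadPart h x) := by
  rw [jointDensity, jointDensity, pathDensity_add hP]
  ring

theorem integrable_pow_mul_pathDensity (hP : P.Regular) (hG : P.Growth H) (b : H) (m : ℕ) :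
    Integrable fun x => (1 + ‖x‖) ^ m * P.pathDensity b x :=
  let ⟨_, h⟩ := exists_integral_pow_mul_pathDensity_le hP hG ‖b‖ m
  (h b le_rfl).1

theorem integrable_jointDensity_mul (hP : P.Regular) (hG : P.Growth H) (y : Fin M → Vec d₀)
    (b : H) {φ : Traj d N → ℝ} (hφ : Measurable φ) (hφ' : PolyGrowth fun (_ : Unit) => φ) :
    Integrable fun x => P.jointDensity y b x * φ x := by
  obtain ⟨C, m, hC, h⟩ := hφ'
  obtain ⟨D, hD, hJ⟩ := exists_jointDensity_le hP hG y
  refine ((integrable_pow_mul_pathDensity hP hG b m).const_mul (D * C)).mono'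
    ((measurable_jointDensity hP y (measurable_apply hG b)).mul hφ).aestronglyMeasurable
    (ae_of_all _ fun x => ?_)
  rw [norm_mul, Real.norm_of_nonneg (jointDensity_nonneg hP y b x)]
  calc P.jointDensity y b x * ‖φ x‖
      ≤ (D * P.pathDensity b x) * (C * (1 + ‖x‖) ^ m) :=
        mul_le_mul (hJ b x) (h () x) (norm_nonneg _)
          (mul_nonneg hD (pathDensity_nonneg hP b x))
    _ = _ := by ring

theorem integrable_jointDensity (hP : P.Regular) (hG : P.Growth H) (y : Fin M → Vec d₀)
    (b : H) : Integrable (P.jointDensity y b) := by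
  simpa using integrable_jointDensity_mul hP hG y b (measurable_const (a := (1 : ℝ)))
    (PolyGrowth.const 1)

/-- The positivity of the likelihood does not depend on the drift, since the support of the joint
density does not. -/
theorem likelihood_pos (hP : P.Regular) (hG : P.Growth H) {y : Fin M → Vec d₀}
    (hy : ∃ b : H, 0 < P.likelihood y b) (b : H) : 0 < P.likelihood y b := by
  obtain ⟨b₀, hb₀⟩ := hy
  have hpos : ∀ b : H, 0 < P.likelihood y b ↔
      0 < volume (Function.support (P.jointDensity y b)) := fun b =>
    integral_pos_iff_support_of_nonneg (jointDensity_nonneg hP y b)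
      (integrable_jointDensity hP hG y b)
  have hsupp : Function.support (P.jointDensity y b) =
      Function.support (P.jointDensity y b₀) := by
    have h : (b : Vec d → Vec d) = b₀ + (b - b₀ : H) := by simp
    ext x
    rw [Function.mem_support, Function.mem_support, h, jointDensity_add hP]
    simp [Real.exp_ne_zero]
  rw [hpos] at hb₀ ⊢
  rwa [hsupp]

theorem measurable_filterDensity (hP : P.Regular) (y : Fin M → Vec d₀) {b : Vec d → Vec d}
    (hb : Measurable b) :
    Measurable fun x => ENNReal.ofReal (P.jointDensity y b x / P.likelihood y b) :=
  ((measurable_jointDensity hP y hb).div_const _).ennreal_ofReal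

theorem toReal_filterDensity_smul (hP : P.Regular) {y : Fin M → Vec d₀} {b : Vec d → Vec d}
    (hL : 0 < P.likelihood y b) (φ : Traj d N → ℝ) (x : Traj d N) :
    (ENNReal.ofReal (P.jointDensity y b x / P.likelihood y b)).toReal • φ x =
      (P.likelihood y b)⁻¹ * (P.jointDensity y b x * φ x) := by
  rw [ENNReal.toReal_ofReal (div_nonneg (jointDensity_nonneg hP y b x) hL.le), smul_eq_mul]
  ring

theorem integral_filterMeasure (hP : P.Regular) {y : Fin M → Vec d₀} {b : Vec d → Vec d}
    (hb : Measurable b) (hL : 0 < P.likelihood y b) (φ : Traj d N → ℝ) :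
    ∫ x, φ x ∂P.filterMeasure y b =
      (P.likelihood y b)⁻¹ * ∫ x, P.jointDensity y b x * φ x := by
  rw [filterMeasure, integral_withDensity_eq_integral_toReal_smul
    (measurable_filterDensity hP y hb) (ae_of_all _ fun _ => ENNReal.ofReal_lt_top),
    ← integral_const_mul]
  simp only [toReal_filterDensity_smul hP hL]

theorem integrable_filterMeasure (hP : P.Regular) {y : Fin M → Vec d₀} {b : Vec d → Vec d}
    (hb : Measurable b) (hL : 0 < P.likelihood y b) {φ : Traj d N → ℝ}
    (hφ : Integrable fun x => P.jointDensity y b x * φ x) :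
    Integrable φ (P.filterMeasure y b) := by
  rw [filterMeasure, integrable_withDensity_iff_integrable_smul'
    (measurable_filterDensity hP y hb) (ae_of_all _ fun _ => ENNReal.ofReal_lt_top)]
  simp only [toReal_filterDensity_smul hP hL]
  exact hφ.const_mul _

theorem integrable_filterMeasure_of_polyGrowth (hP : P.Regular) (hG : P.Growth H)
    {y : Fin M → Vec d₀} {b : H} (hL : 0 < P.likelihood y b) {φ : Traj d N → ℝ}
    (hφ : Measurable φ) (hφ' : PolyGrowth fun (_ : Unit) => φ) :
    Integrable φ (P.filterMeasure y b) :=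
  integrable_filterMeasure hP (measurable_apply hG b) hL
    (integrable_jointDensity_mul hP hG y b hφ hφ')

theorem isProbabilityMeasure_filterMeasure (hP : P.Regular) (hG : P.Growth H)
    {y : Fin M → Vec d₀} {b : H} (hL : 0 < P.likelihood y b) :
    IsProbabilityMeasure (P.filterMeasure y b) := by
  refine ⟨?_⟩
  rw [filterMeasure, withDensity_apply _ MeasurableSet.univ, setLIntegral_univ,
    ← ofReal_integral_eq_lintegral_ofReal ((integrable_jointDensity hP hG y b).div_const _)
      (ae_of_all _ fun x => div_nonneg (jointDensity_nonneg hP y b x) hL.le), integral_div]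
  rw [← likelihood, div_self hL.ne', ENNReal.ofReal_one]

/-- The initial log-density is integrable for the filtering distribution, because `f₀` has finite
entropy and the observation densities are bounded. -/
theorem integrable_log_init_filterMeasure (hP : P.Regular) (hG : P.Growth H)
    {y : Fin M → Vec d₀} {b : H} (hL : 0 < P.likelihood y b) :
    Integrable (fun x => Real.log (P.init (x 0))) (P.filterMeasure y b) := by
  have hb := measurable_apply hG b
  have hlog : Measurable fun u => Real.log (P.init u) := hP.init_measurable.log
  have hlog0 : Measurable fun x : Traj d N => Real.log (P.init (x 0)) :=
    hlog.comp (measurable_pi_apply 0)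
  have hp : Integrable fun x : Traj d N => P.pathDensity b x * Real.log (P.init (x 0)) := by
    refine ⟨((measurable_pathDensity hP hb).mul hlog0).aestronglyMeasurable, ?_⟩
    have hfin := hP.init_entropy.2
    rw [hasFiniteIntegral_iff_enorm] at hfin ⊢
    have h := lintegral_pathDensity_mul_init (N := N) hP hb hlog.enorm
    simp only [enorm_mul, Real.enorm_of_nonneg (hP.init_nonneg _),
      Real.enorm_of_nonneg (pathDensity_nonneg hP b _)] at hfin ⊢
    rw [h]
    exact hfin
  obtain ⟨D, hD, hJ⟩ := exists_jointDensity_le hP hG y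
  refine integrable_filterMeasure hP hb hL ((hp.norm.const_mul D).mono'
    ((measurable_jointDensity hP y hb).mul hlog0).aestronglyMeasurable (ae_of_all _ fun x => ?_))
  rw [norm_mul, norm_mul, Real.norm_of_nonneg (jointDensity_nonneg hP y b x),
    Real.norm_of_nonneg (pathDensity_nonneg hP b x), ← mul_assoc]
  exact mul_le_mul_of_nonneg_right (hJ b x) (norm_nonneg _)

end Filter
variable {H : Type*} [NormedAddCommGroup H] [InnerProductSpace ℝ H] [CompleteSpace H]
  [RKHS ℝ H (Vec d) (Vec d)]

/-! ### The stationarity equation -/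

section Stationarity

theorem polyGrowth_coe_single (hG : P.Growth H) (b : H) :
    PolyGrowth fun (_ : Unit) => (b : Vec d → Vec d) :=
  polyGrowth_coe hG (b := fun _ => b) (B := ‖b‖) fun _ => le_rfl

theorem integrable_score_filterMeasure (hP : P.Regular) (hG : P.Growth H) {y : Fin M → Vec d₀}
    {b : H} (hL : 0 < P.likelihood y b) (h : H) :
    Integrable (P.score b h) (P.filterMeasure y b) :=
  integrable_filterMeasure_of_polyGrowth hP hG hL
    (measurable_score hP (measurable_apply hG b) (measurable_apply hG h))
    (polyGrowth_score hG (polyGrowth_coe_single hG b) (polyGrowth_coe_single hG h))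

theorem integrable_quadPart_filterMeasure (hP : P.Regular) (hG : P.Growth H)
    {y : Fin M → Vec d₀} {b : H} (hL : 0 < P.likelihood y b) (h : H) :
    Integrable (P.quadPart h) (P.filterMeasure y b) :=
  integrable_filterMeasure_of_polyGrowth hP hG hL (measurable_quadPart hP (measurable_apply hG h))
    (polyGrowth_quadPart hG (polyGrowth_coe_single hG h))

theorem integrable_energy_filterMeasure (hP : P.Regular) (hG : P.Growth H)
    {y : Fin M → Vec d₀} {b : H} (hL : 0 < P.likelihood y b) (b' : H) :
    Integrable (P.energy b') (P.filterMeasure y b) :=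
  integrable_filterMeasure_of_polyGrowth hP hG hL (measurable_energy hP (measurable_apply hG b'))
    (polyGrowth_energy hG (polyGrowth_coe_single hG b'))

/-- Up to a constant independent of `b'`, the risk is the expected energy plus the penalty. The
formula for `ln p_X` fails where `f₀` vanishes, but such trajectories are null for `ν_b`. -/
theorem risk_filterMeasure_eq (hP : P.Regular) (hG : P.Growth H) {y : Fin M → Vec d₀} {b : H}
    (hL : 0 < P.likelihood y b) (b' : H) :
    P.risk b' (P.filterMeasure y b) =
      -(∫ x, Real.log (P.init (x 0)) + P.logNormalizerSum x ∂P.filterMeasure y b) +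
        ∫ x, P.energy b' x ∂P.filterMeasure y b + P.reg * ‖b'‖ ^ 2 := by
  have hinit := integrable_log_init_filterMeasure hP hG hL
  have hnorm := integrable_filterMeasure_of_polyGrowth hP hG hL (measurable_logNormalizerSum hP)
    (polyGrowth_logNormalizerSum Unit hP hG)
  have hae : ∀ᵐ x ∂P.filterMeasure y b, Real.log (P.pathDensity b' x) =
      (Real.log (P.init (x 0)) + P.logNormalizerSum x) - P.energy b' x := by
    rw [filterMeasure, ae_withDensity_iff (measurable_filterDensity hP y (measurable_apply hG b))]
    refine ae_of_all _ fun x hx => ?_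
    have h0 : P.init (x 0) ≠ 0 := by
      intro h0
      simp [jointDensity, pathDensity, h0] at hx
    rw [pathDensity_eq_exp hP, Real.log_mul h0 (Real.exp_ne_zero _), Real.log_exp]
    ring
  have hsum : Integrable (fun x => Real.log (P.init (x 0)) + P.logNormalizerSum x)
      (P.filterMeasure y b) := hinit.add hnorm
  rw [risk, integral_congr_ae hae, integral_sub hsum (integrable_energy_filterMeasure hP hG hL b')]
  ring

theorem risk_add (hP : P.Regular) (hG : P.Growth H) {y : Fin M → Vec d₀} {b : H}
    (hL : 0 < P.likelihood y b) (h : H) :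
    P.risk (b + h) (P.filterMeasure y b) = P.risk b (P.filterMeasure y b) +
      (2 * P.reg * inner ℝ b h - ∫ x, P.score b h x ∂P.filterMeasure y b) +
      (∫ x, P.quadPart h x ∂P.filterMeasure y b + P.reg * ‖h‖ ^ 2) := by
  have he : ∫ x, P.energy (b + h : H) x ∂P.filterMeasure y b =
      ∫ x, P.energy b x ∂P.filterMeasure y b - ∫ x, P.score b h x ∂P.filterMeasure y b +
        ∫ x, P.quadPart h x ∂P.filterMeasure y b := by
    have h1 := integrable_energy_filterMeasure hP hG hL b
    have h2 := integrable_score_filterMeasure hP hG hL h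
    have h12 : Integrable (fun x => P.energy b x - P.score b h x) (P.filterMeasure y b) :=
      h1.sub h2
    rw [← integral_sub h1 h2,
      ← integral_add h12 (integrable_quadPart_filterMeasure hP hG hL h)]
    simp only [RKHS.coe_add, energy_add hP]
  rw [risk_filterMeasure_eq hP hG hL, risk_filterMeasure_eq hP hG hL, he, norm_add_sq_real]
  ring

/-- A quadratic polynomial without constant term that is nonnegative near `0` has no linear term. -/
theorem eq_zero_of_eventually_nonneg {A B : ℝ} (h : ∀ᶠ t : ℝ in 𝓝 0, 0 ≤ t * A + t ^ 2 * B) :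
    A = 0 := by
  have hmin : IsLocalMin (fun t : ℝ => t * A + t ^ 2 * B) 0 := by
    filter_upwards [h] with t ht
    simpa using ht
  have hd : HasDerivAt (fun t : ℝ => t * A + t ^ 2 * B) A 0 := by
    exact (((hasDerivAt_id (0 : ℝ)).mul_const A).add
      ((hasDerivAt_pow 2 (0 : ℝ)).mul_const B)).congr_deriv (by simp)
  exact hmin.hasDerivAt_eq_zero hd

/-- As `R(·, ν_b)` is a strictly convex quadratic function, `b` is its unique minimizer if and only
if its derivative vanishes at `b`. -/
theorem mem_stationarySet_iff (hP : P.Regular) (hG : P.Growth H) {y : Fin M → Vec d₀} {b : H}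
    (hL : 0 < P.likelihood y b) :
    b ∈ P.stationarySet H y ↔
      ∀ h : H, ∫ x, P.score b h x ∂P.filterMeasure y b = 2 * P.reg * inner ℝ b h := by
  constructor
  · intro hb h
    have hmin : b ∈ P.riskArgmin H (P.filterMeasure y b) := by
      rw [show P.riskArgmin H (P.filterMeasure y b) = {b} from hb]; rfl
    have hzero := eq_zero_of_eventually_nonneg
      (A := 2 * P.reg * inner ℝ b h - ∫ x, P.score b h x ∂P.filterMeasure y b)
      (B := ∫ x, P.quadPart h x ∂P.filterMeasure y b + P.reg * ‖h‖ ^ 2)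
      (Eventually.of_forall fun t => by
        have h1 := hmin (b + t • h)
        rw [risk_add hP hG hL, integral_score_smul, integral_quadPart_smul, norm_smul,
          real_inner_smul_right, mul_pow, Real.norm_eq_abs, sq_abs] at h1
        linarith)
    linarith
  · intro hb
    have hgap : ∀ b' : H, P.risk b (P.filterMeasure y b) + P.reg * ‖b' - b‖ ^ 2 ≤
        P.risk b' (P.filterMeasure y b) := fun b' => by
      have h1 := risk_add hP hG hL (b' - b)
      rw [add_sub_cancel, hb (b' - b)] at h1
      have h2 : 0 ≤ ∫ x, P.quadPart (b' - b : H) x ∂P.filterMeasure y b :=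
        integral_nonneg fun x => quadPart_nonneg hP _ x
      linarith
    have hreg := hP.reg_pos
    refine Set.eq_singleton_iff_unique_mem.2 ⟨fun b' => ?_, fun b' hb' => ?_⟩
    · have : 0 ≤ P.reg * ‖b' - b‖ ^ 2 := by positivity
      linarith [hgap b']
    · have h1 := hgap b'
      have h2 := hb' b
      have h3 : ‖b' - b‖ ^ 2 ≤ 0 := by
        by_contra hc
        have := mul_pos hreg (not_le.1 hc)
        linarith
      have h4 : ‖b' - b‖ = 0 := by nlinarith [norm_nonneg (b' - b)]
      exact sub_eq_zero.1 (norm_eq_zero.1 h4)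

theorem mem_stationarySet_iff_integral (hP : P.Regular) (hG : P.Growth H) {y : Fin M → Vec d₀}
    {b : H} (hL : 0 < P.likelihood y b) :
    b ∈ P.stationarySet H y ↔ ∀ h : H,
      ∫ x, P.jointDensity y b x * P.score b h x = 2 * P.reg * inner ℝ b h * P.likelihood y b := by
  rw [mem_stationarySet_iff hP hG hL]
  refine forall_congr' fun h => ?_
  rw [integral_filterMeasure hP (measurable_apply hG b) hL, inv_mul_eq_iff_eq_mul₀ hL.ne', mul_comm]

/-- The surrogate `R(·, ν_b)` majorizes the loss up to a constant and touches it at `b`; this is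
Jensen's inequality for the exponential function under `ν_b`. -/
theorem loss_add_le (hP : P.Regular) (hG : P.Growth H) {y : Fin M → Vec d₀}
    (hy : ∃ b : H, 0 < P.likelihood y b) (b h : H) :
    P.loss y (b + h) ≤ P.loss y b +
      (2 * P.reg * inner ℝ b h - ∫ x, P.score b h x ∂P.filterMeasure y b) +
      (∫ x, P.quadPart h x ∂P.filterMeasure y b + P.reg * ‖h‖ ^ 2) := by
  have hL := likelihood_pos hP hG hy b
  have hL' := likelihood_pos hP hG hy (b + h)
  have hb := measurable_apply hG b
  have := isProbabilityMeasure_filterMeasure hP hG hL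
  have hs := integrable_score_filterMeasure hP hG hL h
  have hq := integrable_quadPart_filterMeasure hP hG hL h
  have hJ : ∀ x, P.jointDensity y b x * Real.exp (P.score b h x - P.quadPart h x) =
      P.jointDensity y (b + h : H) x := fun x => by rw [RKHS.coe_add, jointDensity_add hP]
  have hexp : Integrable (Real.exp ∘ fun x => P.score b h x - P.quadPart h x)
      (P.filterMeasure y b) := by
    refine integrable_filterMeasure hP hb hL ?_
    simp only [Function.comp_apply, hJ]
    exact integrable_jointDensity hP hG y (b + h)
  have hjensen := convexOn_exp.map_integral_le Real.continuous_exp.continuousOn isClosed_univ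
    (ae_of_all _ fun _ => Set.mem_univ _) (hs.sub hq) hexp
  simp only [Pi.sub_apply] at hjensen
  rw [integral_sub hs hq, integral_filterMeasure hP hb hL
    fun x => Real.exp (P.score b h x - P.quadPart h x)] at hjensen
  simp only [hJ] at hjensen
  rw [← likelihood, ← Real.le_log_iff_exp_le (mul_pos (inv_pos.2 hL) hL'),
    Real.log_mul (inv_pos.2 hL).ne' hL'.ne', Real.log_inv] at hjensen
  rw [loss, loss, norm_add_sq_real]
  linarith

theorem mem_stationarySet_of_isLocalMin (hP : P.Regular) (hG : P.Growth H) {y : Fin M → Vec d₀}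
    (hy : ∃ b : H, 0 < P.likelihood y b) {b : H}
    (hmin : IsLocalMin (fun b' : H => P.loss y b') b) : b ∈ P.stationarySet H y := by
  rw [mem_stationarySet_iff hP hG (likelihood_pos hP hG hy b)]
  intro h
  have hline : Tendsto (fun t : ℝ => b + t • h) (𝓝 0) (𝓝 b) := by
    have : Continuous fun t : ℝ => b + t • h := by fun_prop
    simpa using this.tendsto 0
  have hzero := eq_zero_of_eventually_nonneg
    (A := 2 * P.reg * inner ℝ b h - ∫ x, P.score b h x ∂P.filterMeasure y b)
    (B := ∫ x, P.quadPart h x ∂P.filterMeasure y b + P.reg * ‖h‖ ^ 2) (by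
      filter_upwards [hline.eventually hmin] with t ht
      have h1 := loss_add_le hP hG hy b (t • h)
      rw [integral_score_smul, integral_quadPart_smul, norm_smul, real_inner_smul_right, mul_pow,
        Real.norm_eq_abs, sq_abs] at h1
      linarith)
  linarith

end Stationarity

/-! ### Weak sequential continuity -/

section WeakContinuity

/-- Point evaluations turn weak convergence into pointwise convergence. -/
theorem tendsto_apply_of_tendsto_inner {b : ℕ → H} {b' : H}
    (hb : ∀ v : H, Tendsto (fun n => inner ℝ v (b n)) atTop (𝓝 (inner ℝ v b'))) (u : Vec d) :
    Tendsto (fun n => b n u) atTop (𝓝 (b' u)) := by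
  have h : Tendsto (fun n => (b n u).ofLp) atTop (𝓝 (b' u).ofLp) := by
    rw [tendsto_pi_nhds]
    intro i
    have h1 := hb (RKHS.kerFun H u (EuclideanSpace.single i 1))
    simp only [RKHS.kerFun_inner, EuclideanSpace.inner_single_left, map_one, one_mul] at h1
    exact h1
  exact ((PiLp.continuous_toLp 2 _).tendsto _).comp h

variable {b h : ℕ → Vec d → Vec d} {b' h' : Vec d → Vec d}

theorem tendsto_residual (hb : ∀ u, Tendsto (fun k => b k u) atTop (𝓝 (b' u))) (n : Fin N)
    (x : Traj d N) :
    Tendsto (fun k => P.residual (b k) n x) atTop (𝓝 (P.residual b' n x)) :=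
  tendsto_const_nhds.sub ((hb _).const_smul P.step)

theorem tendsto_score (hb : ∀ u, Tendsto (fun k => b k u) atTop (𝓝 (b' u)))
    (hh : ∀ u, Tendsto (fun k => h k u) atTop (𝓝 (h' u))) (x : Traj d N) :
    Tendsto (fun k => P.score (b k) (h k) x) atTop (𝓝 (P.score b' h' x)) :=
  tendsto_finsetSum _ fun n _ => (tendsto_residual hb n x).inner
    (((P.precision (x n.castSucc)).continuous.tendsto _).comp (hh _))

theorem tendsto_pathDensity (hP : P.Regular)
    (hb : ∀ u, Tendsto (fun k => b k u) atTop (𝓝 (b' u))) (x : Traj d N) :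
    Tendsto (fun k => P.pathDensity (b k) x) atTop (𝓝 (P.pathDensity b' x)) := by
  simp only [pathDensity_eq_exp hP]
  refine ((Real.continuous_exp.tendsto _).comp (tendsto_const_nhds.sub ?_)).const_mul _
  refine tendsto_finsetSum _ fun n _ => Tendsto.const_mul _ ?_
  exact (tendsto_residual hb n x).inner
    (((P.precision (x n.castSucc)).continuous.tendsto _).comp (tendsto_residual hb n x))

theorem tendsto_jointDensity (hP : P.Regular) (y : Fin M → Vec d₀)
    (hb : ∀ u, Tendsto (fun k => b k u) atTop (𝓝 (b' u))) (x : Traj d N) :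
    Tendsto (fun k => P.jointDensity y (b k) x) atTop (𝓝 (P.jointDensity y b' x)) :=
  (tendsto_pathDensity hP hb x).mul_const _

end WeakContinuity

section WeakContinuity

variable {b h : ℕ → H} {b' h' : H}

/-- Integrals against the joint density are weakly sequentially continuous in the drift. -/
theorem tendsto_integral_jointDensity_mul (hP : P.Regular) (hG : P.Growth H)
    (y : Fin M → Vec d₀)
    (hb : ∀ v : H, Tendsto (fun n => inner ℝ v (b n)) atTop (𝓝 (inner ℝ v b')))
    {φ : ℕ → Traj d N → ℝ} {φ' : Traj d N → ℝ} (hφ : ∀ n, Measurable (φ n))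
    (hφ' : Measurable φ') (hgrowth : PolyGrowth φ)
    (hlim : ∀ x, Tendsto (fun n => φ n x) atTop (𝓝 (φ' x))) :
    Tendsto (fun n => ∫ x, P.jointDensity y (b n) x * φ n x) atTop
      (𝓝 (∫ x, P.jointDensity y b' x * φ' x)) := by
  obtain ⟨B, hB⟩ := exists_norm_le_of_tendsto_inner hb
  have hpt := tendsto_apply_of_tendsto_inner hb
  obtain ⟨C, m, hC, hφC⟩ := hgrowth
  obtain ⟨D, hD, hJ⟩ := exists_jointDensity_le hP hG y
  obtain ⟨K, hK⟩ := exists_integral_pow_mul_pathDensity_le hP hG B (2 * m)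
  have hgrowth' : PolyGrowth fun (_ : Unit) => φ' :=
    ⟨C, m, hC, fun _ x => le_of_tendsto' (hlim x).norm fun n => hφC n x⟩
  have hw : ∀ (b : H), (fun x : Traj d N => (D * (C * (1 + ‖x‖) ^ m)) ^ 2 * P.pathDensity b x) =
      fun x => (D * C) ^ 2 * ((1 + ‖x‖) ^ (2 * m) * P.pathDensity b x) := fun b => by
    funext x
    ring
  refine tendsto_integral_of_abs_le_mul_density (p := fun n => P.pathDensity (b n))
    (q := P.pathDensity b') (w := fun x => D * (C * (1 + ‖x‖) ^ m)) (M := (D * C) ^ 2 * K)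
    (fun n x => pathDensity_nonneg hP _ x)
    (fun n => integrable_pathDensity hP (measurable_apply hG _))
    (fun n => integral_pathDensity hP (measurable_apply hG _))
    (integrable_pathDensity hP (measurable_apply hG _))
    (integral_pathDensity hP (measurable_apply hG _))
    (tendsto_pathDensity hP hpt) (fun n => ?_) (fun n => ?_) ?_
    (fun n => integrable_jointDensity_mul hP hG y _ (hφ n)
      ⟨C, m, hC, fun _ x => hφC n x⟩)
    (integrable_jointDensity_mul hP hG y _ hφ' hgrowth')
    (fun x => (tendsto_jointDensity hP y hpt x).mul (hlim x)) (fun n x => ?_)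
  · rw [hw]
    exact ((hK (b n) (hB n)).1).const_mul _
  · rw [hw, integral_const_mul]
    exact mul_le_mul_of_nonneg_left (hK (b n) (hB n)).2 (sq_nonneg _)
  · rw [hw]
    exact (integrable_pow_mul_pathDensity hP hG b' _).const_mul _
  · rw [abs_mul, abs_of_nonneg (jointDensity_nonneg hP y _ x)]
    calc P.jointDensity y (b n) x * |φ n x|
        ≤ (D * P.pathDensity (b n) x) * (C * (1 + ‖x‖) ^ m) :=
          mul_le_mul (hJ _ x) (hφC n x) (abs_nonneg _)
            (mul_nonneg hD (pathDensity_nonneg hP _ x))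
      _ = _ := by ring

theorem tendsto_likelihood (hP : P.Regular) (hG : P.Growth H) (y : Fin M → Vec d₀)
    (hb : ∀ v : H, Tendsto (fun n => inner ℝ v (b n)) atTop (𝓝 (inner ℝ v b'))) :
    Tendsto (fun n => P.likelihood y (b n)) atTop (𝓝 (P.likelihood y b')) := by
  simpa [likelihood] using tendsto_integral_jointDensity_mul hP hG y hb (φ := fun _ _ => 1)
    (φ' := fun _ => 1) (fun _ => measurable_const) measurable_const (PolyGrowth.const 1)
    fun _ => tendsto_const_nhds

/-- The first-order term of the risk is jointly weakly sequentially continuous in the drift and the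
direction. -/
theorem tendsto_integral_jointDensity_mul_score (hP : P.Regular) (hG : P.Growth H)
    (y : Fin M → Vec d₀)
    (hb : ∀ v : H, Tendsto (fun n => inner ℝ v (b n)) atTop (𝓝 (inner ℝ v b')))
    (hh : ∀ v : H, Tendsto (fun n => inner ℝ v (h n)) atTop (𝓝 (inner ℝ v h'))) :
    Tendsto (fun n => ∫ x, P.jointDensity y (b n) x * P.score (b n) (h n) x) atTop
      (𝓝 (∫ x, P.jointDensity y b' x * P.score b' h' x)) := by
  obtain ⟨B, hB⟩ := exists_norm_le_of_tendsto_inner hb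
  obtain ⟨B', hB'⟩ := exists_norm_le_of_tendsto_inner hh
  exact tendsto_integral_jointDensity_mul hP hG y hb
    (fun n => measurable_score hP (measurable_apply hG _) (measurable_apply hG _))
    (measurable_score hP (measurable_apply hG _) (measurable_apply hG _))
    (polyGrowth_score hG (polyGrowth_coe hG hB) (polyGrowth_coe hG hB'))
    (tendsto_score (tendsto_apply_of_tendsto_inner hb) (tendsto_apply_of_tendsto_inner hh))

theorem mem_stationarySet_of_tendsto_inner (hP : P.Regular) (hG : P.Growth H)
    {y : Fin M → Vec d₀} (hy : ∃ b : H, 0 < P.likelihood y b)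
    (hmem : ∀ n, b n ∈ P.stationarySet H y)
    (hb : ∀ v : H, Tendsto (fun n => inner ℝ v (b n)) atTop (𝓝 (inner ℝ v b'))) :
    b' ∈ P.stationarySet H y := by
  have hpos := likelihood_pos hP hG hy
  rw [mem_stationarySet_iff_integral hP hG (hpos b')]
  intro h
  have h1 := tendsto_integral_jointDensity_mul_score hP hG y hb (h := fun _ => h) (h' := h)
    fun _ => tendsto_const_nhds
  simp only [fun n => (mem_stationarySet_iff_integral hP hG (hpos (b n))).1 (hmem n) h] at h1
  have h2 : Tendsto (fun n => inner ℝ (b n) h) atTop (𝓝 (inner ℝ b' h)) := by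
    simpa only [real_inner_comm] using hb h
  exact tendsto_nhds_unique h1 ((h2.const_mul _).mul (tendsto_likelihood hP hG y hb))

/-- On the stationary set, the stationarity equation in the direction of the drift itself expresses
the norm by weakly continuous quantities. -/
theorem tendsto_of_tendsto_inner_of_mem_stationarySet (hP : P.Regular) (hG : P.Growth H)
    {y : Fin M → Vec d₀} (hy : ∃ b : H, 0 < P.likelihood y b)
    (hmem : ∀ n, b n ∈ P.stationarySet H y)
    (hb : ∀ v : H, Tendsto (fun n => inner ℝ v (b n)) atTop (𝓝 (inner ℝ v b'))) :
    Tendsto b atTop (𝓝 b') := by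
  have hpos := likelihood_pos hP hG hy
  refine tendsto_of_tendsto_inner_of_tendsto_norm hb ?_
  have hnorm : ∀ c : H, c ∈ P.stationarySet H y → ‖c‖ ^ 2 =
      (∫ x, P.jointDensity y c x * P.score c c x) / (2 * P.reg * P.likelihood y c) := by
    intro c hc
    have hreg := hP.reg_pos
    have hc' := hpos c
    rw [(mem_stationarySet_iff_integral hP hG hc').1 hc c, real_inner_self_eq_norm_sq]
    field_simp
  rw [hnorm b' (mem_stationarySet_of_tendsto_inner hP hG hy hmem hb)]
  simp only [fun n => hnorm (b n) (hmem n)]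
  refine (tendsto_integral_jointDensity_mul_score hP hG y hb hb).div
    ((tendsto_likelihood hP hG y hb).const_mul _) ?_
  have := hP.reg_pos
  have := hpos b'
  positivity

theorem isClosed_stationarySet (hP : P.Regular) (hG : P.Growth H) {y : Fin M → Vec d₀}
    (hy : ∃ b : H, 0 < P.likelihood y b) : IsClosed (P.stationarySet H y) :=
  IsSeqClosed.isClosed fun _ _ hb hlim => mem_stationarySet_of_tendsto_inner hP hG hy hb
    fun _ => tendsto_const_nhds.inner hlim

/-- A ball inside the stationary set would contain the weakly but not strongly convergent sequence
`b₀ + r e_n` with `e_n` orthonormal. -/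
theorem isNowhereDense_stationarySet (hP : P.Regular) (hG : P.Growth H) {y : Fin M → Vec d₀}
    (hy : ∃ b : H, 0 < P.likelihood y b) (hH : ¬ FiniteDimensional ℝ H) :
    IsNowhereDense (P.stationarySet H y) := by
  rw [(isClosed_stationarySet hP hG hy).isNowhereDense_iff, Set.eq_empty_iff_forall_notMem]
  intro b₀ hb₀
  obtain ⟨r, hr, hball⟩ := Metric.mem_nhds_iff.1 (mem_interior_iff_mem_nhds.1 hb₀)
  obtain ⟨e, he⟩ := exists_orthonormal_nat_of_not_finiteDimensional hH
  have hnorm : ∀ n, ‖(r / 2) • e n‖ = r / 2 := fun n => by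
    rw [norm_smul, he.1 n, mul_one, Real.norm_of_nonneg (by positivity)]
  have hmem : ∀ n, b₀ + (r / 2) • e n ∈ P.stationarySet H y := fun n => hball <| by
    rw [mem_ball_iff_norm, add_sub_cancel_left, hnorm]
    linarith
  have hweak : ∀ v : H, Tendsto (fun n => inner ℝ v (b₀ + (r / 2) • e n)) atTop
      (𝓝 (inner ℝ v b₀)) := fun v => by
    simp only [inner_add_right, real_inner_smul_right]
    simpa using ((he.tendsto_inner_zero v).const_mul (r / 2)).const_add (inner ℝ v b₀)
  have hstrong := tendsto_of_tendsto_inner_of_mem_stationarySet hP hG hy hmem hweak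
  rw [tendsto_iff_norm_sub_tendsto_zero] at hstrong
  simp only [add_sub_cancel_left, hnorm] at hstrong
  have := tendsto_nhds_unique hstrong tendsto_const_nhds
  linarith

end WeakContinuity

end SDEModel

end
theorem mainTheorem4 {d d₀ N M : ℕ} (P : SDEModel d d₀ N M)
    (H : Type*) [NormedAddCommGroup H] [InnerProductSpace ℝ H] [CompleteSpace H]
    [RKHS ℝ H (Vec d) (Vec d)]
    (hP : P.Regular) (hG : P.Growth H)
    (y : Fin M → Vec d₀) (hy : ∃ b : H, 0 < P.likelihood y b) :
    (IsSeqClosed (toWeakSpace ℝ H '' P.stationarySet H y) ∧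
      IsClosed (P.stationarySet H y)) ∧
    (∀ (b : ℕ → H) (b' : H), (∀ n, b n ∈ P.stationarySet H y) →
      (Tendsto (fun n => toWeakSpace ℝ H (b n)) atTop (𝓝 (toWeakSpace ℝ H b')) ↔
        Tendsto b atTop (𝓝 b'))) ∧
    ((∀ b : H, IsLocalMin (fun b' : H => P.loss y b') b → b ∈ P.stationarySet H y) ∧
      (∀ b : H, (∀ b' : H, P.loss y b ≤ P.loss y b') → b ∈ P.stationarySet H y)) ∧
    (¬ FiniteDimensional ℝ H → IsNowhereDense (P.stationarySet H y)) := by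
  refine ⟨⟨?_, SDEModel.isClosed_stationarySet hP hG hy⟩,
    fun b b' hb => ⟨fun hw => ?_, fun hs => ?_⟩,
    ⟨fun b hb => SDEModel.mem_stationarySet_of_isLocalMin hP hG hy hb, fun b hb =>
      SDEModel.mem_stationarySet_of_isLocalMin hP hG hy (Eventually.of_forall hb)⟩,
    SDEModel.isNowhereDense_stationarySet hP hG hy⟩
  · intro x x' hx hlim
    choose b hb hbx using hx
    obtain ⟨b', rfl⟩ := (toWeakSpace ℝ H).surjective x'
    obtain rfl : (fun n => toWeakSpace ℝ H (b n)) = x := funext hbx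
    exact ⟨b', SDEModel.mem_stationarySet_of_tendsto_inner hP hG hy hb
      (tendsto_toWeakSpace_iff_inner.1 hlim), rfl⟩
  · exact SDEModel.tendsto_of_tendsto_inner_of_mem_stationarySet hP hG hy hb
      (tendsto_toWeakSpace_iff_inner.1 hw)
  · exact tendsto_toWeakSpace_iff_inner.2 fun v => tendsto_const_nhds.inner hs
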